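/- Let $n\ge 0$ be an integer. Equip $\mathbb R^{n+2}$ with $\langle x,y\rangle=-x_0y_0-x_1y_1+x_2y_2+\dots+x_{n+1}y_{n+1}$ and let $H^{n+1}_1(-1)=\{x\in\mathbb R^{n+2}:\langle x,x\rangle=-1\}$ be the anti-de Sitter space. Equip $\mathbb C^{n+2}$ with the Hermitian form $(z,w)=-z_0\bar w_0-z_1\bar w_1+z_2\bar w_2+\dots+z_{n+1}\bar w_{n+1}$. The complex anti-de Sitter space $\mathbb CH^{n+1}_1$ is the set of complex lines of $\mathbb C^{n+2}$ on which this form is negative definite, with the metric for which $\{z:(z,z)=-1\}\to\mathbb CH^{n+1}_1$, $z\mapsto[z]$, is a pseudo-Riemannian submersion with respect to $\operatorname{Re}(\cdot,\cdot)$. The complex hyperbolic quadric is the complex submanifold $$Q^{*n}=\{[z]\in\mathbb CH^{n+1}_1:\ -z_0^2-z_1^2+z_2^2+\dots+z_{n+1}^2=0\}$$ with the induced metric $g$ (which is Riemannian) and the induced complex structure $J$. Let $M$ be a smooth manifold of dimension $n$, let $a:M\to H^{n+1}_1(-1)$ be a smooth spacelike immersion, and let $b:M\to\mathbb R^{n+2}$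 be a smooth unit normal vector field along $a$ tangent to $H^{n+1}_1(-1)$, i.e. $\langle b,b\rangle=-1$, $\langle a,b\rangle=0$ and $\langle da(X),b\rangle=0$ for all tangent vectors $X$. Let $S$, with $da(SX)=-D_Xb$, be the shape operator of $a$ associated to $b$ ($D$ is the flat connection of $\mathbb R^{n+2}$), and let $G:M\to Q^{*n}$, $G(p)=[a(p)+ib(p)]$, be the Gauss map. Then $G$ is a smooth immersion and $S$ has $n$ real eigenvalues at every point, counted with multiplicity. Let $\lambda_1,\dots,\lambda_n:M\to\mathbb R$ be functions (not assumed continuous) whose values at each point are these eigenvalues. Let $H=\frac1n\operatorname{tr}h$ be the mean curvature vector of $G$, where $h$ is the second fundamental form of $G$ with respect to the Levi-Civita connection of $g$, and the trace is taken with respect to the metric induced by $G$. Then the function $\sum_{j=1}^n\arctan\lambda_j$ is smooth, and as one-forms on $M$ $$g(JH,\cdot)=\frac1n\,d\Big(\sum_{j=1}^n\arctan\lambda_j\Big)=\frac1n\,d\,\Big(\operatorname{Im}\log\prod_{j=1}^n(1+i\lambda_j)\Big).$$ Here $\log\prod_j(1+i\lambda_j)$ is any continuous branch of the logarithm of $\prod_j(1+i\lambda_j)$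 on an open subset of $M$, the second equality is meant on that subset (where the imaginary part of the branch is smooth), and such branches exist near every point. For $n=0$ all these one-forms are zero. -/

import Mathlib

open scoped Manifold ContDiff LinearAlgebra.Projectivization

noncomputable section

namespace HyperbolicQuadric

/-! ### Linear algebra of `ℝ^{n+2}_2` and `ℂ^{n+2}_2` -/

/-- The signature `(-1, -1, 1, …, 1)`. -/
def sgn (n : ℕ) (i : Fin (n + 2)) : ℝ := if (i : ℕ) < 2 then -1 else 1

/-- The inner product of index `2` on `ℝ^{n+2}`. -/
def realForm (n : ℕ) : LinearMap.BilinForm ℝ (Fin (n + 2) → ℝ) :=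
  LinearMap.mk₂ ℝ (fun x y => ∑ i, sgn n i * x i * y i)
    (by intro x x' y; simp only [Pi.add_apply, ← Finset.sum_add_distrib]
        exact Finset.sum_congr rfl fun i _ => by ring)
    (by intro c x y; simp only [Pi.smul_apply, smul_eq_mul, Finset.mul_sum]
        exact Finset.sum_congr rfl fun i _ => by ring)
    (by intro x y y'; simp only [Pi.add_apply, ← Finset.sum_add_distrib]
        exact Finset.sum_congr rfl fun i _ => by ring)
    (by intro c x y; simp only [Pi.smul_apply, smul_eq_mul, Finset.mul_sum]
        exact Finset.sum_congr rfl fun i _ => by ring)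

/-- The anti-de Sitter space `H^{n+1}_1(-1)`. -/
def antiDeSitter (n : ℕ) : Set (Fin (n + 2) → ℝ) := {x | realForm n x x = -1}

/-- The Hermitian form `-z₀ w̄₀ - z₁ w̄₁ + z₂ w̄₂ + ⋯` on `ℂ^{n+2}`. -/
def herm {n : ℕ} (z w : Fin (n + 2) → ℂ) : ℂ :=
  ∑ i, (sgn n i : ℂ) * z i * (starRingEnd ℂ) (w i)

/-- The quadratic form `-z₀² - z₁² + z₂² + ⋯` on `ℂ^{n+2}`. -/
def quad {n : ℕ} (z : Fin (n + 2) → ℂ) : ℂ := ∑ i, (sgn n i : ℂ) * z i ^ 2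

lemma herm_add_left {n : ℕ} (z z' w : Fin (n + 2) → ℂ) :
    herm (z + z') w = herm z w + herm z' w := by
  simp only [herm, Pi.add_apply, ← Finset.sum_add_distrib]
  exact Finset.sum_congr rfl fun i _ => by ring

lemma herm_smul_left {n : ℕ} (c : ℂ) (z w : Fin (n + 2) → ℂ) :
    herm (c • z) w = c * herm z w := by
  simp only [herm, Pi.smul_apply, smul_eq_mul, Finset.mul_sum]
  exact Finset.sum_congr rfl fun i _ => by ring

lemma herm_add_right {n : ℕ} (z w w' : Fin (n + 2) → ℂ) :
    herm z (w + w') = herm z w + herm z w' := by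
  simp only [herm, Pi.add_apply, map_add, ← Finset.sum_add_distrib]
  exact Finset.sum_congr rfl fun i _ => by ring

lemma herm_smul_right {n : ℕ} (c : ℂ) (z w : Fin (n + 2) → ℂ) :
    herm z (c • w) = (starRingEnd ℂ) c * herm z w := by
  simp only [herm, Pi.smul_apply, smul_eq_mul, map_mul, Finset.mul_sum]
  exact Finset.sum_congr rfl fun i _ => by ring

lemma quad_smul {n : ℕ} (c : ℂ) (z : Fin (n + 2) → ℂ) : quad (c • z) = c ^ 2 * quad z := by
  simp only [quad, Pi.smul_apply, smul_eq_mul, Finset.mul_sum]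
  exact Finset.sum_congr rfl fun i _ => by ring

lemma herm_smul_smul_re {n : ℕ} (c : ℂ) (z : Fin (n + 2) → ℂ) :
    (herm (c • z) (c • z)).re = ‖c‖ ^ 2 * (herm z z).re := by
  rw [herm_smul_left, herm_smul_right, ← mul_assoc, Complex.mul_conj, Complex.normSq_eq_norm_sq,
    Complex.re_ofReal_mul]

/-- The real part of `herm` in coordinates. -/
lemma herm_self_re {n : ℕ} (z : Fin (n + 2) → ℂ) :
    (herm z z).re = -‖z 0‖ ^ 2 - ‖z 1‖ ^ 2 + ∑ j : Fin n, ‖z j.succ.succ‖ ^ 2 := by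
  have h : ∀ i, ((sgn n i : ℂ) * z i * (starRingEnd ℂ) (z i)).re = sgn n i * ‖z i‖ ^ 2 := by
    intro i
    rw [mul_assoc, Complex.mul_conj, Complex.normSq_eq_norm_sq, Complex.re_ofReal_mul,
      Complex.ofReal_re]
  rw [herm, Complex.re_sum, Finset.sum_congr rfl fun i _ => h i, Fin.sum_univ_succ,
    Fin.sum_univ_succ]
  simp only [sgn, Fin.val_zero, Fin.succ_zero_eq_one, Fin.val_one, Fin.val_succ]
  simp
  ring

lemma quad_eq {n : ℕ} (z : Fin (n + 2) → ℂ) :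
    quad z = -z 0 ^ 2 - z 1 ^ 2 + ∑ j : Fin n, z j.succ.succ ^ 2 := by
  simp only [quad, Fin.sum_univ_succ]
  simp [sgn]
  ring

/-! ### The complex anti-de Sitter space and the complex hyperbolic quadric -/

/-- The complex anti-de Sitter space: the complex lines of `ℂ^{n+2}` on which the form is negative
definite. -/
def complexAntiDeSitter (n : ℕ) : Set (ℙ ℂ (Fin (n + 2) → ℂ)) :=
  {L | ∀ z ∈ L.submodule, z ≠ 0 → (herm z z).re < 0}

/-- The complex hyperbolic quadric `Q*^n` (as a set). -/
def QStar (n : ℕ) : Type :=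
  {L : ℙ ℂ (Fin (n + 2) → ℂ) // L ∈ complexAntiDeSitter n ∧ ∀ z ∈ L.submodule, quad z = 0}

lemma ne_zero_of_neg {n : ℕ} {z : Fin (n + 2) → ℂ} (h : (herm z z).re < 0) : z ≠ 0 := by
  rintro rfl
  simp [herm] at h

/-- The point `[z]` of the quadric. -/
def QStar.mk {n : ℕ} (z : Fin (n + 2) → ℂ) (hneg : (herm z z).re < 0) (hq : quad z = 0) :
    QStar n :=
  ⟨Projectivization.mk ℂ z (ne_zero_of_neg hneg), by
    constructor
    · intro w hw hw0
      rw [Projectivization.submodule_mk, Submodule.mem_span_singleton] at hw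
      obtain ⟨c, rfl⟩ := hw
      have hc : c ≠ 0 := by rintro rfl; simp at hw0
      rw [herm_smul_smul_re]
      have : 0 < ‖c‖ ^ 2 := by positivity
      nlinarith
    · intro w hw
      rw [Projectivization.submodule_mk, Submodule.mem_span_singleton] at hw
      obtain ⟨c, rfl⟩ := hw
      rw [quad_smul, hq, mul_zero]⟩

/-- A representing vector of a point of the quadric. -/
def QStar.rep {n : ℕ} (L : QStar n) : Fin (n + 2) → ℂ := L.1.rep

lemma QStar.rep_mem {n : ℕ} (L : QStar n) : L.rep ∈ L.1.submodule := by
  rw [Projectivization.submodule_eq]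
  exact Submodule.mem_span_singleton_self _

lemma QStar.rep_neg {n : ℕ} (L : QStar n) : (herm L.rep L.rep).re < 0 :=
  L.2.1 _ L.rep_mem L.1.rep_nonzero

lemma QStar.rep_quad {n : ℕ} (L : QStar n) : quad L.rep = 0 := L.2.2 _ L.rep_mem

lemma QStar.exists_rep_mk {n : ℕ} (z : Fin (n + 2) → ℂ) (h1 : (herm z z).re < 0)
    (h2 : quad z = 0) : ∃ c : ℂ, c ≠ 0 ∧ (QStar.mk z h1 h2).rep = c • z := by
  obtain ⟨c, hc⟩ := Projectivization.exists_smul_eq_mk_rep ℂ z (ne_zero_of_neg h1)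
  exact ⟨c, c.ne_zero, hc.symm⟩

lemma QStar.eq_mk {n : ℕ} (L : QStar n) (z : Fin (n + 2) → ℂ) (h1 : (herm z z).re < 0)
    (h2 : quad z = 0) (c : ℂ) (h : L.rep = c • z) : QStar.mk z h1 h2 = L := by
  apply Subtype.ext
  have hL : L.1 = Projectivization.mk ℂ L.rep L.1.rep_nonzero := (L.1.mk_rep).symm
  rw [hL]
  refine ((Projectivization.mk_eq_mk_iff' ℂ _ _ _ _).2 ⟨c, h.symm⟩).symm

/-! ### Holomorphic charts of the quadric

The quadric has two connected components, interchanged by complex conjugation. With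
`α = z₀ - ε i z₁`, `β = z₀ + ε i z₁` its equation reads `α β = z₂² + ⋯ + z_{n+1}²`, and the components
are `|β| < |α|` for `ε = 1` and for `ε = -1`. On such a component `[z] ↦ (z₂, …, z_{n+1}) / α` is a
global holomorphic chart (affine coordinates of the projective space, with `β / α` solved for),
whose image is the Lie ball. -/

/-- `z₀ - ε i z₁`. -/
def nullCoord {n : ℕ} (ε : ℤˣ) (z : Fin (n + 2) → ℂ) : ℂ :=
  z 0 - ((ε : ℤ) : ℂ) * Complex.I * z 1

/-- `w₁² + ⋯ + w_n²`. -/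
def dotSelf {n : ℕ} (w : Fin n → ℂ) : ℂ := ∑ j, w j ^ 2

/-- The Lie ball. -/
def lieBall (n : ℕ) : Set (Fin n → ℂ) :=
  {w | ‖dotSelf w‖ < 1 ∧ 2 * ∑ j, ‖w j‖ ^ 2 < 1 + ‖dotSelf w‖ ^ 2}

/-- The holomorphic lift of the inverse chart, normalized by `z₀ - ε i z₁ = 1`. -/
def coneSection {n : ℕ} (ε : ℤˣ) (w : Fin n → ℂ) : Fin (n + 2) → ℂ :=
  Fin.cons ((1 + dotSelf w) / 2)
    (Fin.cons (((ε : ℤ) : ℂ) * Complex.I * (1 - dotSelf w) / 2) w)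

lemma coneSection_zero {n : ℕ} (ε : ℤˣ) (w : Fin n → ℂ) :
    coneSection ε w 0 = (1 + dotSelf w) / 2 := rfl

lemma coneSection_one {n : ℕ} (ε : ℤˣ) (w : Fin n → ℂ) :
    coneSection ε w 1 = ((ε : ℤ) : ℂ) * Complex.I * (1 - dotSelf w) / 2 := rfl

lemma coneSection_succ {n : ℕ} (ε : ℤˣ) (w : Fin n → ℂ) (j : Fin n) :
    coneSection ε w j.succ.succ = w j := rfl

lemma unit_sq (ε : ℤˣ) : ((ε : ℤ) : ℂ) ^ 2 = 1 := by
  rcases Int.units_eq_one_or ε with rfl | rfl <;> simp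

lemma unit_I_sq (ε : ℤˣ) : (((ε : ℤ) : ℂ) * Complex.I) ^ 2 = -1 := by
  rw [mul_pow, unit_sq, Complex.I_sq, one_mul]

lemma nullCoord_smul {n : ℕ} (ε : ℤˣ) (c : ℂ) (z : Fin (n + 2) → ℂ) :
    nullCoord ε (c • z) = c * nullCoord ε z := by
  simp only [nullCoord, Pi.smul_apply, smul_eq_mul]
  ring

lemma nullCoord_coneSection {n : ℕ} (ε : ℤˣ) (w : Fin n → ℂ) :
    nullCoord ε (coneSection ε w) = 1 := by
  rw [nullCoord, coneSection_zero, coneSection_one]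
  linear_combination (-(1 - dotSelf w) / 2) * unit_I_sq ε

lemma nullCoord_neg_coneSection {n : ℕ} (ε : ℤˣ) (w : Fin n → ℂ) :
    nullCoord (-ε) (coneSection ε w) = dotSelf w := by
  rw [nullCoord, coneSection_zero, coneSection_one]
  push_cast
  linear_combination ((1 - dotSelf w) / 2) * unit_I_sq ε

lemma quad_coneSection {n : ℕ} (ε : ℤˣ) (w : Fin n → ℂ) : quad (coneSection ε w) = 0 := by
  rw [quad_eq, coneSection_zero, coneSection_one]
  simp only [coneSection_succ]
  rw [show ∑ j, w j ^ 2 = dotSelf w from rfl]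
  linear_combination (-((1 - dotSelf w) / 2) ^ 2) * unit_I_sq ε

lemma nullCoord_mul {n : ℕ} (ε : ℤˣ) (z : Fin (n + 2) → ℂ) (hz : quad z = 0) :
    nullCoord ε z * nullCoord (-ε) z = ∑ j : Fin n, z j.succ.succ ^ 2 := by
  rw [quad_eq] at hz
  simp only [nullCoord]
  push_cast
  linear_combination (-z 1 ^ 2) * unit_I_sq ε - hz

lemma parallelogram (ε : ℤˣ) (x y : ℂ) :
    ‖x - ((ε : ℤ) : ℂ) * Complex.I * y‖ ^ 2 + ‖x + ((ε : ℤ) : ℂ) * Complex.I * y‖ ^ 2 =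
      2 * (‖x‖ ^ 2 + ‖y‖ ^ 2) := by
  have h := parallelogram_law_with_norm ℝ x (((ε : ℤ) : ℂ) * Complex.I * y)
  have h2 : ‖((ε : ℤ) : ℂ) * Complex.I * y‖ = ‖y‖ := by
    rcases Int.units_eq_one_or ε with rfl | rfl <;> simp
  rw [h2] at h
  linarith

lemma herm_eq_nullCoord {n : ℕ} (ε : ℤˣ) (z : Fin (n + 2) → ℂ) :
    2 * (herm z z).re = -‖nullCoord ε z‖ ^ 2 - ‖nullCoord (-ε) z‖ ^ 2
      + 2 * ∑ j : Fin n, ‖z j.succ.succ‖ ^ 2 := by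
  have h := parallelogram ε (z 0) (z 1)
  have h2 : nullCoord (-ε) z = z 0 + ((ε : ℤ) : ℂ) * Complex.I * z 1 := by
    simp only [nullCoord]; push_cast; ring
  rw [herm_self_re, h2, nullCoord]
  linarith

/-- On the quadric, `|z₀ - i z₁| ≠ |z₀ + i z₁|`. -/
lemma norm_nullCoord_ne {n : ℕ} (ε : ℤˣ) (z : Fin (n + 2) → ℂ) (hneg : (herm z z).re < 0)
    (hz : quad z = 0) : ‖nullCoord ε z‖ ≠ ‖nullCoord (-ε) z‖ := by
  intro h
  have h1 := herm_eq_nullCoord ε z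
  have h2 : ‖nullCoord ε z‖ * ‖nullCoord (-ε) z‖ ≤ ∑ j : Fin n, ‖z j.succ.succ‖ ^ 2 := by
    rw [← norm_mul, nullCoord_mul ε z hz]
    refine (norm_sum_le _ _).trans (le_of_eq ?_)
    simp only [norm_pow]
  rw [h] at h1 h2
  nlinarith

lemma herm_coneSection_neg {n : ℕ} (ε : ℤˣ) {w : Fin n → ℂ} (hw : w ∈ lieBall n) :
    (herm (coneSection ε w) (coneSection ε w)).re < 0 := by
  have h := herm_eq_nullCoord ε (coneSection ε w)
  rw [nullCoord_coneSection, nullCoord_neg_coneSection] at h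
  simp only [coneSection_succ, norm_one] at h
  have := hw.2
  linarith

lemma zero_mem_lieBall (n : ℕ) : (0 : Fin n → ℂ) ∈ lieBall n := by
  simp [lieBall, dotSelf]

lemma isOpen_lieBall (n : ℕ) : IsOpen (lieBall n) := by
  have h : Continuous (dotSelf : (Fin n → ℂ) → ℂ) := by unfold dotSelf; fun_prop
  have h1 : IsOpen {w : Fin n → ℂ | ‖dotSelf w‖ < 1} := isOpen_lt h.norm continuous_const
  have h2 : IsOpen {w : Fin n → ℂ | 2 * ∑ j, ‖w j‖ ^ 2 < 1 + ‖dotSelf w‖ ^ 2} :=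
    isOpen_lt (by fun_prop) (by fun_prop)
  exact h1.inter h2

open Classical in
/-- The inverse chart. -/
def ofCoord {n : ℕ} (ε : ℤˣ) (w : Fin n → ℂ) : QStar n :=
  if h : w ∈ lieBall n then
    QStar.mk (coneSection ε w) (herm_coneSection_neg ε h) (quad_coneSection ε w)
  else QStar.mk (coneSection ε 0) (herm_coneSection_neg ε (zero_mem_lieBall n))
    (quad_coneSection ε 0)

lemma coneSection_of_rep {n : ℕ} (ε : ℤˣ) (z : Fin (n + 2) → ℂ) (hq : quad z = 0)
    (h0 : nullCoord ε z ≠ 0) :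
    dotSelf (fun j : Fin n => z j.succ.succ / nullCoord ε z) =
        nullCoord (-ε) z / nullCoord ε z ∧
      z = nullCoord ε z • coneSection ε (fun j => z j.succ.succ / nullCoord ε z) := by
  have hd : dotSelf (fun j : Fin n => z j.succ.succ / nullCoord ε z) =
      nullCoord (-ε) z / nullCoord ε z := by
    simp only [dotSelf, div_pow]
    rw [← Finset.sum_div, ← nullCoord_mul ε z hq]
    field_simp
  refine ⟨hd, ?_⟩
  funext i
  rw [Pi.smul_apply, smul_eq_mul]
  refine Fin.cases ?_ (fun i => Fin.cases ?_ (fun j => ?_) i) i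
  · rw [coneSection_zero, hd]
    field_simp
    simp only [nullCoord]; push_cast; ring
  · rw [Fin.succ_zero_eq_one, coneSection_one, hd]
    have e : nullCoord ε z * (((ε : ℤ) : ℂ) * Complex.I *
        (1 - nullCoord (-ε) z / nullCoord ε z) / 2) =
        ((ε : ℤ) : ℂ) * Complex.I * (nullCoord ε z - nullCoord (-ε) z) / 2 := by
      field_simp
    rw [e]
    simp only [nullCoord]; push_cast
    linear_combination (z 1) * unit_I_sq ε
  · rw [coneSection_succ]
    field_simp

/-- The chart `[z] ↦ (z₂, …, z_{n+1}) / (z₀ - ε i z₁)` on a component of the quadric. -/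
def chart (n : ℕ) (ε : ℤˣ) : PartialEquiv (QStar n) (Fin n → ℂ) where
  toFun L := fun j => L.rep j.succ.succ / nullCoord ε L.rep
  invFun := ofCoord ε
  source := {L | ‖nullCoord (-ε) L.rep‖ < ‖nullCoord ε L.rep‖}
  target := lieBall n
  map_source' L hL := by
    have h0 : 0 < ‖nullCoord ε L.rep‖ := lt_of_le_of_lt (norm_nonneg _) hL
    have hd := (coneSection_of_rep ε L.rep L.rep_quad (norm_pos_iff.1 h0)).1
    have hL' : ‖nullCoord (-ε) L.rep‖ < ‖nullCoord ε L.rep‖ := hL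
    constructor
    · rw [hd, norm_div, div_lt_one h0]
      exact hL'
    · rw [hd]
      simp only [norm_div, div_pow]
      rw [← Finset.sum_div]
      have h1 := herm_eq_nullCoord ε L.rep
      have h2 := L.rep_neg
      have h3 : 0 < ‖nullCoord ε L.rep‖ ^ 2 := by positivity
      rw [show 1 + ‖nullCoord (-ε) L.rep‖ ^ 2 / ‖nullCoord ε L.rep‖ ^ 2 =
        (‖nullCoord ε L.rep‖ ^ 2 + ‖nullCoord (-ε) L.rep‖ ^ 2) / ‖nullCoord ε L.rep‖ ^ 2 by
          field_simp, ← mul_div_assoc]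
      apply div_lt_div_of_pos_right _ h3
      linarith
  map_target' w hw := by
    rw [ofCoord, dif_pos hw]
    obtain ⟨c, hc, h⟩ := QStar.exists_rep_mk (coneSection ε w) (herm_coneSection_neg ε hw)
      (quad_coneSection ε w)
    have hc' : 0 < ‖c‖ := norm_pos_iff.2 hc
    change ‖nullCoord (-ε) (QStar.rep _)‖ < ‖nullCoord ε (QStar.rep _)‖
    rw [h, nullCoord_smul, nullCoord_smul, nullCoord_coneSection, nullCoord_neg_coneSection,
      norm_mul, norm_mul, norm_one]
    exact mul_lt_mul_of_pos_left hw.1 hc'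
  left_inv' L hL := by
    have h0 : 0 < ‖nullCoord ε L.rep‖ := lt_of_le_of_lt (norm_nonneg _) hL
    have hd := coneSection_of_rep ε L.rep L.rep_quad (norm_pos_iff.1 h0)
    have hL' : ‖nullCoord (-ε) L.rep‖ < ‖nullCoord ε L.rep‖ := hL
    have hw : (fun j : Fin n => L.rep j.succ.succ / nullCoord ε L.rep) ∈ lieBall n := by
      constructor
      · rw [hd.1, norm_div, div_lt_one h0]
        exact hL'
      · have h1 := herm_eq_nullCoord ε (coneSection ε
          (fun j : Fin n => L.rep j.succ.succ / nullCoord ε L.rep))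
        rw [nullCoord_coneSection, nullCoord_neg_coneSection] at h1
        simp only [coneSection_succ, norm_one] at h1
        have h2 := L.rep_neg
        rw [hd.2, herm_smul_smul_re] at h2
        have h3 : (herm (coneSection ε (fun j : Fin n => L.rep j.succ.succ / nullCoord ε L.rep))
          (coneSection ε (fun j : Fin n => L.rep j.succ.succ / nullCoord ε L.rep))).re < 0 :=
          (pos_iff_neg_of_mul_neg h2).1 (by positivity)
        linarith
    rw [ofCoord, dif_pos hw]
    exact QStar.eq_mk L _ _ _ _ hd.2
  right_inv' w hw := by
    rw [ofCoord, dif_pos hw]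
    obtain ⟨c, hc, h⟩ := QStar.exists_rep_mk (coneSection ε w) (herm_coneSection_neg ε hw)
      (quad_coneSection ε w)
    funext j
    rw [h, nullCoord_smul, nullCoord_coneSection, Pi.smul_apply, coneSection_succ, smul_eq_mul]
    field_simp

open Classical in
/-- The component of a point: `1` if `|z₀ + i z₁| < |z₀ - i z₁|`, and `-1` otherwise. -/
def side {n : ℕ} (L : QStar n) : ℤˣ :=
  if ‖nullCoord (-1) L.rep‖ < ‖nullCoord 1 L.rep‖ then 1 else -1

lemma mem_chart_side {n : ℕ} (L : QStar n) : L ∈ (chart n (side L)).source := by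
  rw [side]
  split_ifs with h
  · exact h
  · have h2 := norm_nullCoord_ne 1 L.rep L.rep_neg L.rep_quad
    change ‖nullCoord (- -1) L.rep‖ < ‖nullCoord (-1) L.rep‖
    rw [neg_neg]
    exact lt_of_le_of_ne (not_lt.1 h) h2

lemma chart_trans {n : ℕ} (ε δ : ℤˣ) :
    (ε = δ ∧ ((chart n ε).symm.trans (chart n δ)).source = lieBall n) ∨
      ((chart n ε).symm.trans (chart n δ)).source = ∅ := by
  by_cases h : ε = δ
  · left
    subst h
    refine ⟨rfl, ?_⟩
    ext w
    simp only [PartialEquiv.trans_source, PartialEquiv.symm_source, Set.mem_inter_iff,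
      Set.mem_preimage]
    exact ⟨fun h => h.1, fun h => ⟨h, (chart n ε).map_target h⟩⟩
  · right
    have hδ : δ = -ε := by
      rcases Int.units_eq_one_or ε with rfl | rfl <;> rcases Int.units_eq_one_or δ with rfl | rfl
        <;> simp_all
    subst hδ
    refine Set.eq_empty_of_forall_notMem fun w hw => ?_
    have h1 : (chart n ε).symm w ∈ (chart n ε).source := (chart n ε).map_target hw.1
    have h2 : (chart n ε).symm w ∈ (chart n (-ε)).source := hw.2
    have h1' : ‖nullCoord (-ε) ((chart n ε).symm w).rep‖ < ‖nullCoord ε ((chart n ε).symm w).rep‖ :=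
      h1
    have h2' : ‖nullCoord (- -ε) ((chart n ε).symm w).rep‖ <
      ‖nullCoord (-ε) ((chart n ε).symm w).rep‖ := h2
    rw [neg_neg] at h2'
    exact lt_asymm h1' h2'

lemma chart_trans_apply {n : ℕ} (ε : ℤˣ) {w : Fin n → ℂ} (hw : w ∈ lieBall n) :
    ((chart n ε).symm.trans (chart n ε)) w = w := (chart n ε).right_inv hw

/-- The atlas of the quadric, consisting of the two charts above. -/
def chartedCore (n : ℕ) : ChartedSpaceCore (Fin n → ℂ) (QStar n) where
  atlas := Set.range (chart n)
  chartAt L := chart n (side L)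
  mem_chart_source := mem_chart_side
  chart_mem_atlas L := ⟨_, rfl⟩
  open_source := by
    rintro _ _ ⟨ε, rfl⟩ ⟨δ, rfl⟩
    rcases chart_trans (n := n) ε δ with ⟨-, h⟩ | h
    · rw [h]; exact isOpen_lieBall n
    · rw [h]; exact isOpen_empty
  continuousOn_toFun := by
    rintro _ _ ⟨ε, rfl⟩ ⟨δ, rfl⟩
    rcases chart_trans (n := n) ε δ with ⟨rfl, h⟩ | h
    · rw [h]; exact continuousOn_id.congr fun w hw => chart_trans_apply ε hw
    · rw [h]; exact continuousOn_empty _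

instance (n : ℕ) : TopologicalSpace (QStar n) := (chartedCore n).toTopologicalSpace

instance (n : ℕ) : ChartedSpace (Fin n → ℂ) (QStar n) := (chartedCore n).toChartedSpace

instance (n : ℕ) (k : ℕ∞ω) : IsManifold 𝓘(ℝ, Fin n → ℂ) k (QStar n) := by
  refine isManifold_of_contDiffOn _ _ _ fun e e' he he' => ?_
  obtain ⟨_, ⟨f, rfl⟩, he⟩ := he
  obtain ⟨_, ⟨⟨ε, rfl⟩, rfl⟩, rfl⟩ := he
  obtain ⟨_, ⟨f', rfl⟩, he'⟩ := he'
  obtain ⟨_, ⟨⟨δ, rfl⟩, rfl⟩, rfl⟩ := he'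
  rcases chart_trans (n := n) ε δ with ⟨rfl, h⟩ | h
  · refine contDiff_id.contDiffOn.congr fun w hw => ?_
    have hw' : w ∈ ((chart n ε).symm.trans (chart n ε)).source := hw.1
    rw [h] at hw'
    exact chart_trans_apply ε hw'
  · intro w hw
    have hw' : w ∈ ((chart n ε).symm.trans (chart n δ)).source := hw.1
    rw [h] at hw'
    exact hw'.elim

/-! ### The Kähler structure of the quadric -/

/-- The part of `a` orthogonal to the complex line spanned by `z`. -/
def horizontal {n : ℕ} (z a : Fin (n + 2) → ℂ) : Fin (n + 2) → ℂ :=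
  a - (herm a z / herm z z) • z

lemma horizontal_add {n : ℕ} (z a b : Fin (n + 2) → ℂ) :
    horizontal z (a + b) = horizontal z a + horizontal z b := by
  simp only [horizontal, herm_add_left, add_div, add_smul]
  abel

lemma horizontal_smul {n : ℕ} (z : Fin (n + 2) → ℂ) (c : ℝ) (a : Fin (n + 2) → ℂ) :
    horizontal z (c • a) = c • horizontal z a := by
  have : c • a = (c : ℂ) • a := by ext; simp
  rw [this]
  simp only [horizontal, herm_smul_left]
  ext i
  simp
  ring

/-- The real bilinear form `(a, b) ↦ g (dπ a) (dπ b)` on `T_z ℂ^{n+2}`, for `π : z ↦ [z]` on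
`{z | ⟪z, z⟫ < 0}`. On vectors `z` with `⟪z, z⟫ = -1` it is the product of the horizontal parts, so
that the restriction of `π` to these vectors (the Hopf fibration) is a pseudo-Riemannian submersion;
the division by `-⟪z, z⟫` accounts for `[z] = [r z]`, `dπ_z a = dπ_{rz} (r a)`. -/
def hopfForm {n : ℕ} (z : Fin (n + 2) → ℂ) : LinearMap.BilinForm ℝ (Fin (n + 2) → ℂ) :=
  LinearMap.mk₂ ℝ (fun a b => (herm (horizontal z a) (horizontal z b)).re / -(herm z z).re)
    (by intro a a' b
        rw [horizontal_add, herm_add_left, Complex.add_re, add_div])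
    (by intro c a b
        have : c • horizontal z a = (c : ℂ) • horizontal z a := by ext; simp
        rw [horizontal_smul, this, herm_smul_left, Complex.re_ofReal_mul, smul_eq_mul, mul_div_assoc])
    (by intro a b b'
        rw [horizontal_add, herm_add_right, Complex.add_re, add_div])
    (by intro c a b
        have : c • horizontal z b = (c : ℂ) • horizontal z b := by ext; simp
        rw [horizontal_smul, this, herm_smul_right, Complex.conj_ofReal, Complex.re_ofReal_mul,
          smul_eq_mul, mul_div_assoc])

/-- The metric of the quadric in the chart with index `ε`, at the point with coordinates `w`. -/
def coordMetric {n : ℕ} (ε : ℤˣ) (w : Fin n → ℂ) : LinearMap.BilinForm ℝ (Fin n → ℂ) :=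
  (hopfForm (coneSection ε w)).compl₁₂ (fderiv ℝ (coneSection ε) w : _ →ₗ[ℝ] _)
    (fderiv ℝ (coneSection ε) w : _ →ₗ[ℝ] _)

/-- The coordinates of a point of the quadric in its chart. -/
def coord {n : ℕ} (L : QStar n) : Fin n → ℂ := chart n (side L) L

/-- The Riemannian metric `g` of the quadric; `TangentSpace 𝓘(ℝ, Fin n → ℂ) L` is `Fin n → ℂ`, via
the chart at `L`. -/
def metric {n : ℕ} (L : QStar n) : LinearMap.BilinForm ℝ (TangentSpace 𝓘(ℝ, Fin n → ℂ) L) :=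
  coordMetric (side L) (coord L)

/-- The complex structure of the quadric: multiplication by `i` in the holomorphic charts. -/
def complexStructure {n : ℕ} (L : QStar n) (ξ : TangentSpace 𝓘(ℝ, Fin n → ℂ) L) :
    TangentSpace 𝓘(ℝ, Fin n → ℂ) L :=
  let ξ' : Fin n → ℂ := ξ
  fun j => Complex.I * ξ' j

/-- The Koszul formula for `g (∇_ξ η) ζ`, where `ξ, η, ζ` have constant coordinates. -/
def koszul {n : ℕ} (ε : ℤˣ) (w ξ η ζ : Fin n → ℂ) : ℝ :=
  (fderiv ℝ (fun w' => coordMetric ε w' η ζ) w ξ + fderiv ℝ (fun w' => coordMetric ε w' ξ ζ) w η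
    - fderiv ℝ (fun w' => coordMetric ε w' ξ η) w ζ) / 2

/-- The Christoffel symbol of the Levi-Civita connection: `christoffel ε w ξ η` is the value of
`∇_ξ η` at `w` for vector fields with constant coordinates `ξ, η`, that is, the vector (unique
because the metric is positive definite) with `g (∇_ξ η) ζ = koszul ξ η ζ` for all `ζ`. -/
def christoffel {n : ℕ} (ε : ℤˣ) (w ξ η : Fin n → ℂ) : Fin n → ℂ :=
  Classical.epsilon fun v => ∀ ζ, coordMetric ε w v ζ = koszul ε w ξ η ζ

/-! ### Submanifold geometry

The tangent space `TangentSpace (𝓡 n) p` is `EuclideanSpace ℝ (Fin n)`, via the preferred chart. -/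

section Linear

variable {n : ℕ} {F : Type*} [AddCommGroup F] [Module ℝ F]

/-- The vectors of the standard basis. -/
def stdVec {n : ℕ} (i : Fin n) : EuclideanSpace ℝ (Fin n) := EuclideanSpace.single i 1

/-- The Gram matrix of the pull-back of `B` by `T`. -/
def gram (B : LinearMap.BilinForm ℝ F) (T : EuclideanSpace ℝ (Fin n) →ₗ[ℝ] F) :
    Matrix (Fin n) (Fin n) ℝ :=
  Matrix.of fun i j => B (T (stdVec i)) (T (stdVec j))

/-- If the pull-back of `B` by `T` is nondegenerate, `tangentialPart B T v` is the vector whose image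
by `T` is the `B`-orthogonal projection of `v` to the range of `T`. -/
def tangentialPart (B : LinearMap.BilinForm ℝ F) (T : EuclideanSpace ℝ (Fin n) →ₗ[ℝ] F) :
    F →ₗ[ℝ] EuclideanSpace ℝ (Fin n) :=
  ∑ i, ∑ j, (gram B T)⁻¹ i j • (B.flip (T (stdVec j))).smulRight (stdVec i)

end Linear

section Manifold

variable {n : ℕ} {M : Type*} [TopologicalSpace M] [ChartedSpace (EuclideanSpace ℝ (Fin n)) M]

/-- The differential at `p` of a map to `ℝ^{n+2}`. -/
def dReal (f : M → Fin (n + 2) → ℝ) (p : M) :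
    EuclideanSpace ℝ (Fin n) →ₗ[ℝ] (Fin (n + 2) → ℝ) :=
  (mfderiv (𝓡 n) 𝓘(ℝ, Fin (n + 2) → ℝ) f p :
    EuclideanSpace ℝ (Fin n) →L[ℝ] (Fin (n + 2) → ℝ)).toLinearMap

/-- `a` is a smooth spacelike immersion into the anti-de Sitter space and `b` is a smooth unit normal
vector field along it, tangent to the anti-de Sitter space. -/
structure IsSpacelikeWithNormal (a b : M → Fin (n + 2) → ℝ) : Prop where
  contMDiff : ContMDiff (𝓡 n) 𝓘(ℝ, Fin (n + 2) → ℝ) ∞ a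
  mem : ∀ p, a p ∈ antiDeSitter n
  spacelike : ∀ p X, X ≠ 0 → 0 < realForm n (dReal a p X) (dReal a p X)
  contMDiff_normal : ContMDiff (𝓡 n) 𝓘(ℝ, Fin (n + 2) → ℝ) ∞ b
  unit : ∀ p, realForm n (b p) (b p) = -1
  tangent : ∀ p, realForm n (a p) (b p) = 0
  normal : ∀ p X, realForm n (dReal a p X) (b p) = 0

/-- The shape operator `S = -∇b` of `a` associated to `b` (Weingarten formula): `da (S X)` is the
tangential part of `-D_X b`. -/
def shapeOperator (a b : M → Fin (n + 2) → ℝ) (p : M) :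
    Module.End ℝ (EuclideanSpace ℝ (Fin n)) :=
  -(tangentialPart (realForm n) (dReal a p) ∘ₗ dReal b p)

/-- At every point, `lam 1, …, lam n` are the eigenvalues of the shape operator, with
multiplicities. -/
def IsPrincipalCurvatures (a b : M → Fin (n + 2) → ℝ) (lam : Fin n → M → ℝ) : Prop :=
  ∀ p, (shapeOperator a b p).charpoly = ∏ j, (Polynomial.X - Polynomial.C (lam j p))

lemma herm_complex {x y : Fin (n + 2) → ℝ} :
    (herm (fun i => (x i : ℂ) + Complex.I * y i) (fun i => (x i : ℂ) + Complex.I * y i)).re =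
      realForm n x x + realForm n y y := by
  simp only [herm, realForm, LinearMap.mk₂_apply, Complex.re_sum, ← Finset.sum_add_distrib]
  refine Finset.sum_congr rfl fun i _ => ?_
  simp

lemma quad_complex {x y : Fin (n + 2) → ℝ} :
    quad (fun i => (x i : ℂ) + Complex.I * y i) =
      ((realForm n x x - realForm n y y : ℝ) : ℂ) + 2 * Complex.I * (realForm n x y : ℝ) := by
  simp only [quad, realForm, LinearMap.mk₂_apply]
  push_cast
  rw [← Finset.sum_sub_distrib, Finset.mul_sum, ← Finset.sum_add_distrib]
  refine Finset.sum_congr rfl fun i _ => ?_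
  linear_combination ((sgn n i : ℂ) * (y i : ℂ) ^ 2) * Complex.I_sq

/-- The differential at `p` of a real function. -/
def dFun (f : M → ℝ) (p : M) (X : TangentSpace (𝓡 n) p) : ℝ := mfderiv (𝓡 n) 𝓘(ℝ, ℝ) f p X

/-- The Gauss map `p ↦ [a p + i b p]`. -/
def gaussMap {a b : M → Fin (n + 2) → ℝ} (h : IsSpacelikeWithNormal a b) (p : M) : QStar n :=
  QStar.mk (fun i => (a p i : ℂ) + Complex.I * b p i)
    (by have h1 : realForm n (a p) (a p) = -1 := h.mem p
        rw [herm_complex, h1, h.unit p]; norm_num)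
    (by have h1 : realForm n (a p) (a p) = -1 := h.mem p
        rw [quad_complex, h1, h.unit p, h.tangent p]; simp)

/-- The differential at `p` of a map to the quadric. -/
def dQuad (f : M → QStar n) (p : M) : EuclideanSpace ℝ (Fin n) →ₗ[ℝ] (Fin n → ℂ) :=
  (mfderiv (𝓡 n) 𝓘(ℝ, Fin n → ℂ) f p : EuclideanSpace ℝ (Fin n) →L[ℝ] (Fin n → ℂ)).toLinearMap

/-- The covariant derivative `∇_X (df Y)` at `p`, where `∇` is the Levi-Civita connection of the
quadric and `Y` is extended with constant coordinates in the chart of `M` at `p`. -/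
def covariantHessian (f : M → QStar n) (p : M) (X Y : EuclideanSpace ℝ (Fin n)) : Fin n → ℂ :=
  fderiv ℝ (fderiv ℝ (writtenInExtChartAt (𝓡 n) 𝓘(ℝ, Fin n → ℂ) p f))
      (extChartAt (𝓡 n) p p) X Y
    + christoffel (side (f p)) (coord (f p)) (dQuad f p X) (dQuad f p Y)

/-- The second fundamental form of `f`: the normal part of `∇_X (df Y)`. -/
def secondFundamentalForm (f : M → QStar n) (p : M) (X Y : EuclideanSpace ℝ (Fin n)) :
    Fin n → ℂ :=
  covariantHessian f p X Y -
    dQuad f p (tangentialPart (metric (f p)) (dQuad f p) (covariantHessian f p X Y))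

/-- The mean curvature vector of `f`: `1 / n` times the trace of the second fundamental form with
respect to the induced metric. -/
def meanCurvature (f : M → QStar n) (p : M) : TangentSpace 𝓘(ℝ, Fin n → ℂ) (f p) :=
  ((1 / n : ℝ) • ∑ i, ∑ j, (gram (metric (f p)) (dQuad f p))⁻¹ i j •
    secondFundamentalForm f p (stdVec i) (stdVec j) : Fin n → ℂ)

/-- The one-form `g (J H, ·)` of an immersion `f` with mean curvature vector `H`. -/
def maslovForm (f : M → QStar n) (p : M) (X : TangentSpace (𝓡 n) p) : ℝ :=
  metric (f p) (complexStructure (f p) (meanCurvature f p))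
    (mfderiv (𝓡 n) 𝓘(ℝ, Fin n → ℂ) f p X)

end Manifold

end HyperbolicQuadric

end

open HyperbolicQuadric

/-! The map `z = a + i b` lifts the Gauss map `G`: it takes values in the cone over the quadric,
`(z, z) = -2`, and `dz` is horizontal because `da` and `db` are orthogonal to both `a` and `b`.
Hence the Hermitian metric of the quadric pulls back to half of `(dz X, dz Y)`, whose imaginary part
`⟪db X, da Y⟫ - ⟪da X, db Y⟫` vanishes by the symmetry of `S`. So `G` is Lagrangian with induced
metric `Γ = (I + III) / 2`. The form `III` is nonnegative, since `db X` is again tangent to the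
immersion; thus `Γ` is positive definite (`coordMetric_gaussCoord`, `coordMetric_gaussCoord_pos`).

The Levi-Civita connection is computed in the holomorphic charts. The derivative of the Hermitian
metric splits into a part for the first vector and a conjugate part for the second. The connection
read off from this splitting is torsion free (`liftedDeriv_comm`), so the Koszul formula collapses
to one term (`koszul_eq`). Up to vertical vectors the covariant Hessian of `G` lifts to the second
derivative of `z` (`lifted_covariantHessian`), whence `C(X, Y, W) = g(∇_X dG Y, J dG W) = (⟪b_XY,
a_W⟫ - ⟪a_XY, b_W⟫) / 2`. This form is totally symmetric, by the symmetry of second derivatives and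
the differentiated symmetry of `S`. As `G` is Lagrangian, tangential parts do not contribute, and `n
g(JH, dG X) = -tr (Γ⁻¹ C_X)`.

On the other side, `∏ (1 + i λ_j) = det (I + i II) / det I`, which is smooth although the `λ_j` need
not be. Jacobi's formula and `2 Γ = I (1 + S²)` show that the imaginary part of its logarithmic
derivative is also `-tr (Γ⁻¹ C_X)` (`im_trace_inv_mul`, `hasDerivAt_angleDet`).

Finally, the eigenvalues are multiplied by `t ∈ [0, 1]`: the homotopy from the trivial case `t = 0`
shows that `∑ arctan λ_j` is, near each point, a continuous argument of the product, without any
continuity of the individual `λ_j` (`sum_arctan_eventually_eq`). -/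

namespace HyperbolicQuadric

/-! ### The Hermitian form -/

section Herm

variable {n : ℕ}

lemma herm_conj (z w : Fin (n + 2) → ℂ) : (starRingEnd ℂ) (herm z w) = herm w z := by
  simp only [herm, map_sum, map_mul, Complex.conj_ofReal, Complex.conj_conj]
  exact Finset.sum_congr rfl fun i _ => by ring

lemma herm_self_eq (z : Fin (n + 2) → ℂ) : herm z z = ((herm z z).re : ℂ) :=
  ((Complex.conj_eq_iff_re (z := herm z z)).1 (herm_conj z z)).symm

lemma herm_self_ne_zero {z : Fin (n + 2) → ℂ} (h : (herm z z).re < 0) : herm z z ≠ 0 := by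
  intro h0
  rw [h0] at h
  simp at h

lemma hasDerivAt_herm {u v : ℝ → Fin (n + 2) → ℂ} {u' v' : Fin (n + 2) → ℂ} {t : ℝ}
    (hu : HasDerivAt u u' t) (hv : HasDerivAt v v' t) :
    HasDerivAt (fun s => herm (u s) (v s)) (herm u' (v t) + herm (u t) v') t := by
  simp only [herm, ← Finset.sum_add_distrib]
  refine HasDerivAt.fun_sum fun i _ => ?_
  have h1 := (hasDerivAt_pi.1 hu i).const_mul (sgn n i : ℂ)
  have h2 : HasDerivAt (fun s => (starRingEnd ℂ) (v s i)) ((starRingEnd ℂ) (v' i)) t :=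
    (Complex.conjCLE.toContinuousLinearMap.hasFDerivAt.comp_hasDerivAt t (hasDerivAt_pi.1 hv i))
  exact h1.mul h2

lemma differentiableAt_herm {E : Type*} [NormedAddCommGroup E] [NormedSpace ℝ E]
    {u v : E → Fin (n + 2) → ℂ} {x : E} (hu : DifferentiableAt ℝ u x)
    (hv : DifferentiableAt ℝ v x) : DifferentiableAt ℝ (fun s => herm (u s) (v s)) x := by
  simp only [herm]
  refine DifferentiableAt.fun_sum fun i _ => ?_
  have h2 : DifferentiableAt ℝ (fun s => (starRingEnd ℂ) (v s i)) x :=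
    Complex.conjCLE.toContinuousLinearMap.differentiableAt.comp x (differentiableAt_pi.1 hv i)
  exact ((differentiableAt_pi.1 hu i).const_mul _).mul h2

/-- The Hermitian form whose real part is `hopfForm`. -/
noncomputable def hopfHerm (z a b : Fin (n + 2) → ℂ) : ℂ :=
  herm a z * herm z b / herm z z ^ 2 - herm a b / herm z z

/-- Since `herm z z` is real, expanding the horizontal parts removes the projection. The outcome is
sesquilinear over `ℂ`, so that `J` acts through scalars, and it is an explicit quotient that can be
differentiated. -/
lemma hopfForm_apply {z : Fin (n + 2) → ℂ} (hz : (herm z z).re < 0) (a b : Fin (n + 2) → ℂ) :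
    hopfForm z a b = (hopfHerm z a b).re := by
  have h0 := herm_self_ne_zero hz
  have h1 : hopfHerm z a b = herm (horizontal z a) (horizontal z b) / ((-(herm z z).re : ℝ) : ℂ) := by
    have e : horizontal z a = a + (-(herm a z / herm z z)) • z := by
      rw [horizontal, neg_smul, sub_eq_add_neg]
    have e' : horizontal z b = b + (-(herm b z / herm z z)) • z := by
      rw [horizontal, neg_smul, sub_eq_add_neg]
    rw [e, e', Complex.ofReal_neg, ← herm_self_eq]
    simp only [herm_add_left, herm_add_right, herm_smul_left, herm_smul_right, map_neg, map_div₀,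
      herm_conj, hopfHerm]
    field_simp
    ring
  rw [h1, Complex.div_ofReal_re]
  rfl

lemma hopfHerm_add_left (z a a' b : Fin (n + 2) → ℂ) :
    hopfHerm z (a + a') b = hopfHerm z a b + hopfHerm z a' b := by
  simp only [hopfHerm, herm_add_left]; ring

lemma hopfHerm_smul_left (z a b : Fin (n + 2) → ℂ) (c : ℂ) :
    hopfHerm z (c • a) b = c * hopfHerm z a b := by
  simp only [hopfHerm, herm_smul_left]; ring

lemma hopfHerm_conj (z a b : Fin (n + 2) → ℂ) :
    (starRingEnd ℂ) (hopfHerm z a b) = hopfHerm z b a := by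
  simp only [hopfHerm, map_sub, map_div₀, map_mul, map_pow, herm_conj]; ring

lemma hopfHerm_add_right (z a b b' : Fin (n + 2) → ℂ) :
    hopfHerm z a (b + b') = hopfHerm z a b + hopfHerm z a b' := by
  simp only [hopfHerm, herm_add_right]; ring

lemma hopfHerm_smul_right (z a b : Fin (n + 2) → ℂ) (c : ℂ) :
    hopfHerm z a (c • b) = (starRingEnd ℂ) c * hopfHerm z a b := by
  simp only [hopfHerm, herm_smul_right]; ring

lemma hopfHerm_self_left {z : Fin (n + 2) → ℂ} (hz : herm z z ≠ 0) (b : Fin (n + 2) → ℂ) :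
    hopfHerm z z b = 0 := by
  simp only [hopfHerm]; field_simp; ring

/-- This expresses `[c z] = [z]` and `dπ_{cz} (c a) = dπ_z a`. It lets the normalized lift of a
chart be exchanged for `a + i b`. -/
lemma hopfHerm_smul_smul_smul (z a b : Fin (n + 2) → ℂ) {c : ℂ} (hc : c ≠ 0) :
    hopfHerm (c • z) (c • a) (c • b) = hopfHerm z a b := by
  have hc' : (starRingEnd ℂ) c ≠ 0 := (map_ne_zero _).2 hc
  simp only [hopfHerm, herm_smul_right, herm_smul_left]
  by_cases hz : herm z z = 0
  · simp [hz]
  · field_simp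

/-- The derivative of `hopfHerm` along a curve, split into the part coming from the derivatives of
the first arguments and its conjugate part. -/
lemma hasDerivAt_hopfHerm {z a b : ℝ → Fin (n + 2) → ℂ} {z' a' b' : Fin (n + 2) → ℂ} {t : ℝ}
    (hz : HasDerivAt z z' t) (ha : HasDerivAt a a' t) (hb : HasDerivAt b b' t)
    (h0 : herm (z t) (z t) ≠ 0) :
    HasDerivAt (fun s => hopfHerm (z s) (a s) (b s))
      ((hopfHerm (z t) a' (b t) - herm (a t) (z t) / herm (z t) (z t) * hopfHerm (z t) z' (b t)
          - herm z' (z t) / herm (z t) (z t) * hopfHerm (z t) (a t) (b t)) +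
        (starRingEnd ℂ) (hopfHerm (z t) b' (a t)
          - herm (b t) (z t) / herm (z t) (z t) * hopfHerm (z t) z' (a t)
          - herm z' (z t) / herm (z t) (z t) * hopfHerm (z t) (b t) (a t))) t := by
  have hN := hasDerivAt_herm hz hz
  have h1 := (((hasDerivAt_herm ha hz).mul (hasDerivAt_herm hz hb)).div (hN.pow 2)
    (pow_ne_zero 2 h0)).sub ((hasDerivAt_herm ha hb).div hN h0)
  refine h1.congr_deriv ?_
  simp only [hopfHerm, map_sub, map_mul, map_div₀, map_pow, herm_conj, Pi.mul_apply, Pi.pow_apply]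
  field_simp
  ring

end Herm

/-! ### The metric in the holomorphic charts -/

section Chart

variable {n : ℕ}

/-- The directional derivative of `coneSection ε` at `w`. -/
noncomputable def coneTangent (ε : ℤˣ) (w ξ : Fin n → ℂ) : Fin (n + 2) → ℂ :=
  Fin.cons (∑ j, w j * ξ j) (Fin.cons (-(((ε : ℤ) : ℂ) * Complex.I * ∑ j, w j * ξ j)) ξ)

/-- The second derivative of `coneSection ε`. -/
noncomputable def coneHess (ε : ℤˣ) (ξ η : Fin n → ℂ) : Fin (n + 2) → ℂ :=
  Fin.cons (∑ j, ξ j * η j) (Fin.cons (-(((ε : ℤ) : ℂ) * Complex.I * ∑ j, ξ j * η j)) 0)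

lemma coneHess_comm (ε : ℤˣ) (ξ η : Fin n → ℂ) : coneHess ε ξ η = coneHess ε η ξ := by
  simp only [coneHess, mul_comm]

lemma hasDerivAt_fin_cons {f : ℝ → ℂ} {g : ℝ → Fin n → ℂ} {f' : ℂ} {g' : Fin n → ℂ} {t : ℝ}
    (hf : HasDerivAt f f' t) (hg : HasDerivAt g g' t) :
    HasDerivAt (fun s => (Fin.cons (f s) (g s) : Fin (n + 1) → ℂ)) (Fin.cons f' g') t := by
  refine hasDerivAt_pi.2 fun i => ?_
  refine Fin.cases ?_ (fun j => ?_) i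
  · simpa using hf
  · simpa using hasDerivAt_pi.1 hg j

lemma hasDerivAt_sum_mul {w ξ : ℝ → Fin n → ℂ} {w' ξ' : Fin n → ℂ} {t : ℝ}
    (hw : HasDerivAt w w' t) (hξ : HasDerivAt ξ ξ' t) :
    HasDerivAt (fun s => ∑ j, w s j * ξ s j) (∑ j, w' j * ξ t j + ∑ j, w t j * ξ' j) t := by
  rw [← Finset.sum_add_distrib]
  exact HasDerivAt.fun_sum fun j _ => (hasDerivAt_pi.1 hw j).mul (hasDerivAt_pi.1 hξ j)

lemma hasDerivAt_coneSection (ε : ℤˣ) {w : ℝ → Fin n → ℂ} {w' : Fin n → ℂ} {t : ℝ}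
    (hw : HasDerivAt w w' t) :
    HasDerivAt (fun s => coneSection ε (w s)) (coneTangent ε (w t) w') t := by
  have h : HasDerivAt (fun s => dotSelf (w s)) (2 * ∑ j, w t j * w' j) t := by
    have := hasDerivAt_sum_mul hw hw
    simp only [dotSelf, sq]
    refine this.congr_deriv ?_
    rw [two_mul]
    simp only [mul_comm]
  refine hasDerivAt_fin_cons (((h.const_add 1).div_const 2).congr_deriv (by ring))
    (hasDerivAt_fin_cons ((((h.const_sub 1).const_mul _).div_const 2).congr_deriv ?_) hw)
  ring

lemma hasDerivAt_coneTangent (ε : ℤˣ) {w ξ : ℝ → Fin n → ℂ} {w' ξ' : Fin n → ℂ} {t : ℝ}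
    (hw : HasDerivAt w w' t) (hξ : HasDerivAt ξ ξ' t) :
    HasDerivAt (fun s => coneTangent ε (w s) (ξ s))
      (coneHess ε w' (ξ t) + coneTangent ε (w t) ξ') t := by
  have h := hasDerivAt_sum_mul hw hξ
  refine (hasDerivAt_fin_cons h (hasDerivAt_fin_cons (h.const_mul _).neg hξ)).congr_deriv ?_
  funext i
  refine Fin.cases ?_ (fun i => Fin.cases ?_ (fun j => ?_) i) i
  · simp [coneHess, coneTangent]
  · simp [coneHess, coneTangent]; ring
  · simp [coneHess, coneTangent]

lemma contDiff_coneSection (ε : ℤˣ) : ContDiff ℝ ∞ (coneSection (n := n) ε) := by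
  refine contDiff_pi.2 fun i => ?_
  refine Fin.cases ?_ (fun i => Fin.cases ?_ (fun j => ?_) i) i
  · simp only [coneSection_zero, dotSelf]; fun_prop
  · simp only [Fin.succ_zero_eq_one, coneSection_one, dotSelf]; fun_prop
  · simp only [coneSection_succ]; fun_prop

lemma hasDerivAt_line {E : Type*} [NormedAddCommGroup E] [NormedSpace ℝ E] (x v : E) (t : ℝ) :
    HasDerivAt (fun s : ℝ => x + s • v) v t := by
  simpa using ((hasDerivAt_id t).smul_const v).const_add x

/-- Differential identities are checked along lines, which reduces them to calculus in one real
variable. -/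
lemma hasDerivAt_comp_line {E F : Type*} [NormedAddCommGroup E] [NormedSpace ℝ E]
    [NormedAddCommGroup F] [NormedSpace ℝ F] {f : E → F} {x : E} (hf : DifferentiableAt ℝ f x)
    (v : E) : HasDerivAt (fun s : ℝ => f (x + s • v)) (fderiv ℝ f x v) 0 :=
  hf.hasFDerivAt.hasLineDerivAt v

lemma fderiv_coneSection (ε : ℤˣ) (w ξ : Fin n → ℂ) :
    fderiv ℝ (coneSection ε) w ξ = coneTangent ε w ξ := by
  have h1 := hasDerivAt_comp_line
    ((contDiff_coneSection (n := n) ε).differentiable (by simp) w) ξ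
  have h2 := hasDerivAt_coneSection ε (hasDerivAt_line w ξ 0)
  simp only [zero_smul, add_zero] at h2
  exact h1.unique h2

lemma coneTangent_add (ε : ℤˣ) (w ξ η : Fin n → ℂ) :
    coneTangent ε w (ξ + η) = coneTangent ε w ξ + coneTangent ε w η := by
  simp only [← fderiv_coneSection, map_add]

lemma coneTangent_smul (ε : ℤˣ) (w ξ : Fin n → ℂ) (c : ℂ) :
    coneTangent ε w (c • ξ) = c • coneTangent ε w ξ := by
  have h : ∑ j, w j * (c * ξ j) = c * ∑ j, w j * ξ j := by
    rw [Finset.mul_sum]; exact Finset.sum_congr rfl fun j _ => by ring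
  funext i
  refine Fin.cases ?_ (fun i => Fin.cases ?_ (fun j => ?_) i) i
  · simp [coneTangent, h]
  · simp [coneTangent, h]; ring
  · simp [coneTangent]

lemma differentiable_coneTangent (ε : ℤˣ) (ξ : Fin n → ℂ) :
    Differentiable ℝ fun w => coneTangent ε w ξ := by
  refine differentiable_pi.2 fun i => ?_
  refine Fin.cases ?_ (fun i => Fin.cases ?_ (fun j => ?_) i) i
  · simp only [coneTangent, Fin.cons_zero]; fun_prop
  · simp only [coneTangent, Fin.cons_succ, Fin.cons_zero]; fun_prop
  · simp only [coneTangent, Fin.cons_succ]; fun_prop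

/-- The Hermitian metric in the chart with index `ε`. -/
noncomputable def coordHerm (ε : ℤˣ) (w ξ η : Fin n → ℂ) : ℂ :=
  hopfHerm (coneSection ε w) (coneTangent ε w ξ) (coneTangent ε w η)

lemma coordMetric_apply (ε : ℤˣ) {w : Fin n → ℂ}
    (hw : (herm (coneSection ε w) (coneSection ε w)).re < 0) (ξ η : Fin n → ℂ) :
    coordMetric ε w ξ η = (coordHerm ε w ξ η).re := by
  rw [coordHerm, ← hopfForm_apply hw, ← fderiv_coneSection, ← fderiv_coneSection]
  rfl

lemma coordMetric_comm (ε : ℤˣ) {w : Fin n → ℂ}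
    (hw : (herm (coneSection ε w) (coneSection ε w)).re < 0) (ξ η : Fin n → ℂ) :
    coordMetric ε w ξ η = coordMetric ε w η ξ := by
  rw [coordMetric_apply ε hw, coordMetric_apply ε hw, coordHerm, coordHerm, ← hopfHerm_conj,
    Complex.conj_re]

lemma coordMetric_I_left (ε : ℤˣ) {w : Fin n → ℂ}
    (hw : (herm (coneSection ε w) (coneSection ε w)).re < 0) (ξ η : Fin n → ℂ) :
    coordMetric ε w (Complex.I • ξ) η = -coordMetric ε w ξ (Complex.I • η) := by
  rw [coordMetric_apply ε hw, coordMetric_apply ε hw, coordHerm, coordHerm, coneTangent_smul,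
    coneTangent_smul, hopfHerm_smul_left, hopfHerm_smul_right, Complex.conj_I]
  simp

/-- The derivative of the lifted vector field with constant coordinates `η` in the direction `ξ`,
up to multiples of the position vector: its horizontal part lifts `∇_ξ η`. -/
noncomputable def liftedDeriv (ε : ℤˣ) (w ξ η : Fin n → ℂ) : Fin (n + 2) → ℂ :=
  coneHess ε ξ η
    - (herm (coneTangent ε w η) (coneSection ε w) / herm (coneSection ε w) (coneSection ε w)) •
        coneTangent ε w ξ
    - (herm (coneTangent ε w ξ) (coneSection ε w) / herm (coneSection ε w) (coneSection ε w)) •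
        coneTangent ε w η

lemma liftedDeriv_comm (ε : ℤˣ) (w ξ η : Fin n → ℂ) :
    liftedDeriv ε w ξ η = liftedDeriv ε w η ξ := by
  rw [liftedDeriv, liftedDeriv, coneHess_comm]
  abel

/-- Compatibility of the metric with the connection: for fields with constant coordinates the
derivative of `coneTangent` is `coneHess`, and the two halves of `hasDerivAt_hopfHerm` become the
lifted derivatives of `η` and of `ζ`. -/
lemma fderiv_coordMetric (ε : ℤˣ) {w : Fin n → ℂ}
    (hw : (herm (coneSection ε w) (coneSection ε w)).re < 0) (ξ η ζ : Fin n → ℂ) :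
    fderiv ℝ (fun w' => coordMetric ε w' η ζ) w ξ =
      (hopfHerm (coneSection ε w) (liftedDeriv ε w ξ η) (coneTangent ε w ζ)).re +
      (hopfHerm (coneSection ε w) (liftedDeriv ε w ξ ζ) (coneTangent ε w η)).re := by
  have hc : Differentiable ℝ (coneSection (n := n) ε) :=
    (contDiff_coneSection (n := n) ε).differentiable (by simp)
  have h0 := herm_self_ne_zero hw
  have hd : DifferentiableAt ℝ (fun w' => coordHerm ε w' η ζ) w := by
    have a1 := differentiableAt_herm (differentiable_coneTangent ε η w) (hc w)
    have a2 := differentiableAt_herm (hc w) (differentiable_coneTangent ε ζ w)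
    have a3 := differentiableAt_herm (hc w) (hc w)
    have a4 := differentiableAt_herm (differentiable_coneTangent ε η w)
      (differentiable_coneTangent ε ζ w)
    have a5 : DifferentiableAt ℝ (fun w' => herm (coneSection ε w') (coneSection ε w') ^ 2) w :=
      a3.pow 2
    simp only [coordHerm, hopfHerm, div_eq_mul_inv]
    exact ((a1.mul a2).mul (a5.inv (pow_ne_zero 2 h0))).sub (a4.mul (a3.inv h0))
  -- The two forms were compared only at negative vectors. This is an open condition, so the
  -- equality holds near `w` and may be differentiated.
  have hev : (fun w' => coordMetric ε w' η ζ) =ᶠ[nhds w] fun w' => (coordHerm ε w' η ζ).re := by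
    have : ContinuousAt (fun w' => (herm (coneSection ε w') (coneSection ε w')).re) w :=
      Complex.continuous_re.continuousAt.comp (differentiableAt_herm (hc w) (hc w)).continuousAt
    filter_upwards [this.eventually (gt_mem_nhds hw)] with w' hw'
    exact coordMetric_apply ε hw' η ζ
  rw [hev.fderiv_eq]
  have h1 : HasDerivAt (fun s : ℝ => coordHerm ε (w + s • ξ) η ζ)
      (fderiv ℝ (fun w' => coordHerm ε w' η ζ) w ξ) 0 := hasDerivAt_comp_line hd ξ
  have hl := hasDerivAt_line w ξ 0
  have h2 := hasDerivAt_hopfHerm (hasDerivAt_coneSection ε hl)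
    (hasDerivAt_coneTangent ε hl (hasDerivAt_const 0 η))
    (hasDerivAt_coneTangent ε hl (hasDerivAt_const 0 ζ)) (by simpa using h0)
  simp only [zero_smul, add_zero] at h2
  have h3 := h1.unique h2
  have h4 : fderiv ℝ (fun w' => (coordHerm ε w' η ζ).re) w ξ =
      (fderiv ℝ (fun w' => coordHerm ε w' η ζ) w ξ).re := by
    have := (Complex.reCLM.hasFDerivAt (x := coordHerm ε w η ζ)).comp w hd.hasFDerivAt
    rw [show (fun w' => (coordHerm ε w' η ζ).re) =
      Complex.reCLM ∘ fun w' => coordHerm ε w' η ζ from rfl, this.fderiv]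
    rfl
  have hz : coneTangent ε w (0 : Fin n → ℂ) = 0 := by
    rw [← fderiv_coneSection, map_zero]
  rw [h4, h3, Complex.add_re, Complex.conj_re]
  simp only [liftedDeriv, sub_eq_add_neg, hopfHerm_add_left, ← neg_smul, hopfHerm_smul_left, hz,
    add_zero]
  simp only [neg_mul]

/-- The quadric is Kähler: the Koszul formula reduces to one term. -/
lemma koszul_eq (ε : ℤˣ) {w : Fin n → ℂ}
    (hw : (herm (coneSection ε w) (coneSection ε w)).re < 0) (ξ η ζ : Fin n → ℂ) :
    koszul ε w ξ η ζ =
      (hopfHerm (coneSection ε w) (liftedDeriv ε w ξ η) (coneTangent ε w ζ)).re := by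
  rw [koszul, fderiv_coordMetric ε hw, fderiv_coordMetric ε hw, fderiv_coordMetric ε hw,
    liftedDeriv_comm ε w η ξ, liftedDeriv_comm ε w ζ ξ, liftedDeriv_comm ε w ζ η]
  ring

/-- `christoffel` is a choice, meaningful only if some vector satisfies the Koszul formula. The
right-hand side is linear in `ζ` and the metric is nondegenerate at `w` by `hpos`, so such a vector
exists. -/
lemma christoffel_spec (ε : ℤˣ) {w : Fin n → ℂ}
    (hw : (herm (coneSection ε w) (coneSection ε w)).re < 0)
    (hpos : ∀ ξ, ξ ≠ 0 → 0 < coordMetric ε w ξ ξ) (ξ η ζ : Fin n → ℂ) :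
    coordMetric ε w (christoffel ε w ξ η) ζ =
      (hopfHerm (coneSection ε w) (liftedDeriv ε w ξ η) (coneTangent ε w ζ)).re := by
  have hnd : (coordMetric ε w).Nondegenerate := by
    constructor
    · intro x hx
      by_contra h
      exact (hpos x h).ne' (hx x)
    · intro x hx
      by_contra h
      exact (hpos x h).ne' (hx x)
  let L : Module.Dual ℝ (Fin n → ℂ) :=
    { toFun := fun ζ =>
        (hopfHerm (coneSection ε w) (liftedDeriv ε w ξ η) (coneTangent ε w ζ)).re
      map_add' := fun x y => by rw [coneTangent_add, hopfHerm_add_right, Complex.add_re]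
      map_smul' := fun c x => by
        have : c • x = (c : ℂ) • x := by ext; simp
        rw [this, coneTangent_smul, hopfHerm_smul_right, Complex.conj_ofReal,
          Complex.re_ofReal_mul]
        rfl }
  have hex : ∃ v, ∀ ζ, coordMetric ε w v ζ = koszul ε w ξ η ζ :=
    ⟨((coordMetric ε w).toDual hnd).symm L, fun ζ => by
      rw [LinearMap.BilinForm.apply_toDual_symm_apply, koszul_eq ε hw]; rfl⟩
  rw [← koszul_eq ε hw]
  exact Classical.epsilon_spec hex ζ

end Chart

/-! ### Local computations for a pair of maps on an open subset of a Euclidean space -/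

section RealForm

variable {n : ℕ}

lemma realForm_comm (x y : Fin (n + 2) → ℝ) : realForm n x y = realForm n y x := by
  simp only [realForm, LinearMap.mk₂_apply]
  exact Finset.sum_congr rfl fun i _ => by ring

lemma hasDerivAt_realForm {u v : ℝ → Fin (n + 2) → ℝ} {u' v' : Fin (n + 2) → ℝ} {t : ℝ}
    (hu : HasDerivAt u u' t) (hv : HasDerivAt v v' t) :
    HasDerivAt (fun s => realForm n (u s) (v s)) (realForm n u' (v t) + realForm n (u t) v') t := by
  simp only [realForm, LinearMap.mk₂_apply, ← Finset.sum_add_distrib]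
  exact HasDerivAt.fun_sum fun i _ =>
    ((hasDerivAt_pi.1 hu i).const_mul (sgn n i)).mul (hasDerivAt_pi.1 hv i)

/-- The vector `x + i y`. -/
noncomputable def cplx (x y : Fin (n + 2) → ℝ) : Fin (n + 2) → ℂ :=
  fun i => (x i : ℂ) + Complex.I * y i

lemma herm_cplx (x y x' y' : Fin (n + 2) → ℝ) :
    herm (cplx x y) (cplx x' y') = ((realForm n x x' + realForm n y y' : ℝ) : ℂ) +
      Complex.I * ((realForm n y x' - realForm n x y' : ℝ) : ℂ) := by
  simp only [herm, realForm, LinearMap.mk₂_apply, cplx]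
  push_cast
  rw [← Finset.sum_add_distrib, ← Finset.sum_sub_distrib, Finset.mul_sum, ← Finset.sum_add_distrib]
  refine Finset.sum_congr rfl fun i _ => ?_
  simp only [map_add, map_mul, Complex.conj_ofReal, Complex.conj_I]
  linear_combination (-(sgn n i : ℂ) * (y i : ℂ) * (y' i : ℂ)) * Complex.I_sq

lemma hasDerivAt_cplx {u v : ℝ → Fin (n + 2) → ℝ} {u' v' : Fin (n + 2) → ℝ} {t : ℝ}
    (hu : HasDerivAt u u' t) (hv : HasDerivAt v v' t) :
    HasDerivAt (fun s => cplx (u s) (v s)) (cplx u' v') t :=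
  hasDerivAt_pi.2 fun i => (hasDerivAt_pi.1 hu i).ofReal_comp.add
    ((hasDerivAt_pi.1 hv i).ofReal_comp.const_mul Complex.I)

lemma contDiffAt_cplx {E : Type*} [NormedAddCommGroup E] [NormedSpace ℝ E]
    {u v : E → Fin (n + 2) → ℝ} {x : E} (hu : ContDiffAt ℝ ∞ u x) (hv : ContDiffAt ℝ ∞ v x) :
    ContDiffAt ℝ ∞ (fun s => cplx (u s) (v s)) x :=
  contDiffAt_pi.2 fun i => (Complex.ofRealCLM.contDiff.contDiffAt.comp x (contDiffAt_pi.1 hu i)).add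
    (contDiffAt_const.mul (Complex.ofRealCLM.contDiff.contDiffAt.comp x (contDiffAt_pi.1 hv i)))

end RealForm

/-! ### Differentiation along lines -/

section Lines

variable {E F : Type*} [NormedAddCommGroup E] [NormedSpace ℝ E]
  [NormedAddCommGroup F] [NormedSpace ℝ F]

/-- The device for differentiating an identity that holds only near a point. -/
lemma hasDerivAt_line_unique {f g : E → F} {x v : E} {a b : F}
    (hfg : ∀ᶠ y in nhds x, f y = g y) (hf : HasDerivAt (fun t : ℝ => f (x + t • v)) a 0)
    (hg : HasDerivAt (fun t : ℝ => g (x + t • v)) b 0) : a = b := by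
  have hc : Filter.Tendsto (fun t : ℝ => x + t • v) (nhds 0) (nhds x) := by
    have : Continuous fun t : ℝ => x + t • v := by fun_prop
    simpa using this.tendsto 0
  exact hf.unique (hg.congr_of_eventuallyEq (hc.eventually hfg))

lemma hasDerivAt_fderiv_line {f : E → F} {x : E} (hf : ContDiffAt ℝ ∞ f x) (X Y : E) :
    HasDerivAt (fun t : ℝ => fderiv ℝ f (x + t • X) Y) (fderiv ℝ (fderiv ℝ f) x X Y) 0 := by
  have h1 : DifferentiableAt ℝ (fderiv ℝ f) x :=
    (hf.fderiv_right (m := 1) (by norm_cast)).differentiableAt (by simp)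
  have h := hasDerivAt_comp_line h1 X
  simpa using h.clm_apply (hasDerivAt_const (0 : ℝ) Y)

lemma eventually_contDiffAt {f : E → F} {x : E} (hf : ContDiffAt ℝ ∞ f x) :
    ∀ᶠ y in nhds x, DifferentiableAt ℝ f y :=
  ((hf.of_le (m := 1) (by norm_cast)).eventually (by simp)).mono
    fun _ h => h.differentiableAt (by simp)

lemma fderiv_fderiv_comm {f : E → F} {x : E} (hf : ContDiffAt ℝ ∞ f x) (X Y : E) :
    fderiv ℝ (fderiv ℝ f) x X Y = fderiv ℝ (fderiv ℝ f) x Y X :=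
  (hf.isSymmSndFDerivAt (by simp; norm_cast)) X Y

end Lines

/-! ### Fronts on a normed space and the geometry of their Gauss map -/

section Local

variable {n : ℕ} {E : Type*} [NormedAddCommGroup E] [NormedSpace ℝ E]

/-- The conditions of `IsSpacelikeWithNormal` near a point of a normed space. -/
structure IsLocalFront (A B : E → Fin (n + 2) → ℝ) (x : E) : Prop where
  smooth : ContDiffAt ℝ ∞ A x
  smooth_normal : ContDiffAt ℝ ∞ B x
  mem : ∀ᶠ y in nhds x, realForm n (A y) (A y) = -1
  unit : ∀ᶠ y in nhds x, realForm n (B y) (B y) = -1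
  tangent : ∀ᶠ y in nhds x, realForm n (A y) (B y) = 0
  normal : ∀ᶠ y in nhds x, ∀ X, realForm n (fderiv ℝ A y X) (B y) = 0
  spacelike : ∀ᶠ y in nhds x, ∀ X, X ≠ 0 → 0 < realForm n (fderiv ℝ A y X) (fderiv ℝ A y X)

namespace IsLocalFront

variable {A B : E → Fin (n + 2) → ℝ} {x : E} (h : IsLocalFront A B x)
include h

lemma realForm_fderiv_self :
    ∀ᶠ y in nhds x, ∀ X, realForm n (fderiv ℝ A y X) (A y) = 0 := by
  filter_upwards [h.mem.eventually_nhds, eventually_contDiffAt h.smooth] with y hy hA X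
  have h1 := hasDerivAt_comp_line hA X
  have h2 := hasDerivAt_line_unique hy (hasDerivAt_realForm h1 h1) (hasDerivAt_const 0 (-1))
  rw [zero_smul, add_zero, realForm_comm (A y)] at h2
  linarith

lemma realForm_fderiv_normal_self :
    ∀ᶠ y in nhds x, ∀ X, realForm n (fderiv ℝ B y X) (B y) = 0 := by
  filter_upwards [h.unit.eventually_nhds, eventually_contDiffAt h.smooth_normal] with y hy hA X
  have h1 := hasDerivAt_comp_line hA X
  have h2 := hasDerivAt_line_unique hy (hasDerivAt_realForm h1 h1) (hasDerivAt_const 0 (-1))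
  rw [zero_smul, add_zero, realForm_comm (B y)] at h2
  linarith

lemma realForm_fderiv_normal :
    ∀ᶠ y in nhds x, ∀ X, realForm n (fderiv ℝ B y X) (A y) = 0 := by
  filter_upwards [h.tangent.eventually_nhds, eventually_contDiffAt h.smooth_normal,
    eventually_contDiffAt h.smooth, h.normal] with y hy hB hA hn X
  have h2 := hasDerivAt_line_unique hy
    (hasDerivAt_realForm (hasDerivAt_comp_line hA X) (hasDerivAt_comp_line hB X))
    (hasDerivAt_const 0 0)
  rw [zero_smul, add_zero, hn, realForm_comm (A y)] at h2
  linarith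

/-- Differentiability at a point spreads to a neighbourhood for each finite order, and order two is
enough for the symmetry of the shape operator. -/
lemma eventually_smooth :
    ∀ᶠ y in nhds x, ContDiffAt ℝ 2 A y ∧ ContDiffAt ℝ 2 B y :=
  ((h.smooth.of_le (m := 2) (by norm_cast)).eventually (by simp)).and
    ((h.smooth_normal.of_le (m := 2) (by norm_cast)).eventually (by simp))

/-- The shape operator is symmetric. -/
lemma realForm_fderiv_fderiv_comm :
    ∀ᶠ y in nhds x, ∀ X Y, realForm n (fderiv ℝ A y X) (fderiv ℝ B y Y) =
      realForm n (fderiv ℝ B y X) (fderiv ℝ A y Y) := by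
  filter_upwards [h.normal.eventually_nhds, h.eventually_smooth] with y hy hd X Y
  have key : ∀ X Y, realForm n (fderiv ℝ (fderiv ℝ A) y X Y) (B y) +
      realForm n (fderiv ℝ A y Y) (fderiv ℝ B y X) = 0 := by
    intro X Y
    have hA : HasDerivAt (fun t : ℝ => fderiv ℝ A (y + t • X) Y)
        (fderiv ℝ (fderiv ℝ A) y X Y) 0 := by
      have h1 : DifferentiableAt ℝ (fderiv ℝ A) y :=
        (hd.1.fderiv_right (m := 1) (by norm_cast)).differentiableAt (by simp)
      simpa using (hasDerivAt_comp_line h1 X).clm_apply (hasDerivAt_const (0 : ℝ) Y)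
    have hB := hasDerivAt_comp_line (hd.2.differentiableAt (by simp)) X
    have h2 := hasDerivAt_line_unique (hy.mono fun z hz => hz Y) (hasDerivAt_realForm hA hB)
      (hasDerivAt_const 0 0)
    simpa using h2
  have h1 := key X Y
  have h2 := key Y X
  rw [(hd.1.isSymmSndFDerivAt (by simp)) X Y] at h1
  rw [realForm_comm (fderiv ℝ B y X)]
  linarith

/-- The derivative of the symmetry of the shape operator. -/
lemma codazzi (W X Y : E) :
    realForm n (fderiv ℝ (fderiv ℝ A) x W X) (fderiv ℝ B x Y) +
      realForm n (fderiv ℝ A x X) (fderiv ℝ (fderiv ℝ B) x W Y) =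
    realForm n (fderiv ℝ (fderiv ℝ B) x W X) (fderiv ℝ A x Y) +
      realForm n (fderiv ℝ B x X) (fderiv ℝ (fderiv ℝ A) x W Y) := by
  have h2 := hasDerivAt_line_unique (h.realForm_fderiv_fderiv_comm.mono fun z hz => hz X Y)
    (hasDerivAt_realForm (hasDerivAt_fderiv_line h.smooth W X)
      (hasDerivAt_fderiv_line h.smooth_normal W Y))
    (hasDerivAt_realForm (hasDerivAt_fderiv_line h.smooth_normal W X)
      (hasDerivAt_fderiv_line h.smooth W Y))
  simpa using h2

end IsLocalFront

/-- The coordinates of `[A + i B]` in the chart with index `ε`. -/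
noncomputable def gaussCoord (ε : ℤˣ) (A B : E → Fin (n + 2) → ℝ) (y : E) : Fin n → ℂ :=
  fun j => cplx (A y) (B y) j.succ.succ / nullCoord ε (cplx (A y) (B y))

/-- The cubic form `⟪∇_X dG Y, i dG W⟫`. -/
noncomputable def cubicForm (A B : E → Fin (n + 2) → ℝ) (x X Y W : E) : ℝ :=
  (realForm n (fderiv ℝ (fderiv ℝ B) x X Y) (fderiv ℝ A x W) -
    realForm n (fderiv ℝ (fderiv ℝ A) x X Y) (fderiv ℝ B x W)) / 2

namespace IsLocalFront

variable {A B : E → Fin (n + 2) → ℝ} {x : E} (h : IsLocalFront A B x) {ε : ℤˣ}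
include h

lemma cubicForm_comm_left (X Y W : E) : cubicForm A B x X Y W = cubicForm A B x Y X W := by
  rw [cubicForm, fderiv_fderiv_comm h.smooth, fderiv_fderiv_comm h.smooth_normal]
  rfl

/-- A rearrangement of `codazzi`. Together with `cubicForm_comm_left` it makes the cubic form
totally symmetric. -/
lemma cubicForm_comm_right (X Y W : E) : cubicForm A B x X Y W = cubicForm A B x X W Y := by
  have := h.codazzi X Y W
  rw [cubicForm, cubicForm]
  rw [realForm_comm (fderiv ℝ A x Y), realForm_comm (fderiv ℝ B x Y)] at this
  linarith

lemma herm_cplx_self : ∀ᶠ y in nhds x, herm (cplx (A y) (B y)) (cplx (A y) (B y)) = -2 := by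
  filter_upwards [h.mem, h.unit] with y h1 h2
  rw [herm_cplx, h1, h2, realForm_comm (A y)]
  norm_num

lemma quad_cplx_self : ∀ᶠ y in nhds x, quad (cplx (A y) (B y)) = 0 := by
  filter_upwards [h.mem, h.unit, h.tangent] with y h1 h2 h3
  have : quad (cplx (A y) (B y)) = _ := quad_complex
  rw [this, h1, h2, h3]
  simp

/-- Both `dA` and `dB` are orthogonal to `A` and to `B`, so `A + i B` is a horizontal lift. -/
lemma herm_cplx_fderiv : ∀ᶠ y in nhds x, ∀ X,
    herm (cplx (fderiv ℝ A y X) (fderiv ℝ B y X)) (cplx (A y) (B y)) = 0 := by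
  filter_upwards [h.realForm_fderiv_self, h.realForm_fderiv_normal_self, h.realForm_fderiv_normal,
    h.normal] with y h1 h2 h3 h4 X
  rw [herm_cplx, h1, h2, h3, h4]
  simp

lemma herm_cplx_fderiv_fderiv (X Y : E) :
    herm (cplx (fderiv ℝ A x X) (fderiv ℝ B x X)) (cplx (fderiv ℝ A x Y) (fderiv ℝ B x Y)) =
      ((realForm n (fderiv ℝ A x X) (fderiv ℝ A x Y) +
        realForm n (fderiv ℝ B x X) (fderiv ℝ B x Y) : ℝ) : ℂ) := by
  rw [herm_cplx, h.realForm_fderiv_fderiv_comm.self_of_nhds X Y]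
  simp

lemma contDiffAt_nullCoord :
    ContDiffAt ℝ ∞ (fun y => nullCoord ε (cplx (A y) (B y))) x := by
  have := contDiffAt_pi.1 (contDiffAt_cplx h.smooth h.smooth_normal)
  exact (this 0).sub (contDiffAt_const.mul (this 1))

variable (h0 : nullCoord ε (cplx (A x) (B x)) ≠ 0)
include h0

lemma contDiffAt_inv_nullCoord :
    ContDiffAt ℝ ∞ (fun y => (nullCoord ε (cplx (A y) (B y)))⁻¹) x :=
  h.contDiffAt_nullCoord.inv h0

lemma contDiffAt_gaussCoord : ContDiffAt ℝ ∞ (gaussCoord ε A B) x :=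
  contDiffAt_pi.2 fun j => by
    simp only [gaussCoord, div_eq_mul_inv]
    exact (contDiffAt_pi.1 (contDiffAt_cplx h.smooth h.smooth_normal) _).mul
      (h.contDiffAt_inv_nullCoord h0)

lemma coneSection_gaussCoord : ∀ᶠ y in nhds x, coneSection ε (gaussCoord ε A B y) =
    (nullCoord ε (cplx (A y) (B y)))⁻¹ • cplx (A y) (B y) := by
  filter_upwards [h.quad_cplx_self,
    h.contDiffAt_nullCoord.continuousAt.eventually_ne h0] with y hq h1
  have := (coneSection_of_rep ε _ hq h1).2
  rw [eq_inv_smul_iff₀ h1]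
  exact this.symm

/-- The Leibniz rule for the rescaled lift. The term with the derivative of the factor is vertical,
hence invisible to the metric. -/
lemma coneTangent_gaussCoord : ∀ᶠ y in nhds x, ∀ X,
    coneTangent ε (gaussCoord ε A B y) (fderiv ℝ (gaussCoord ε A B) y X) =
      (nullCoord ε (cplx (A y) (B y)))⁻¹ • cplx (fderiv ℝ A y X) (fderiv ℝ B y X) +
      fderiv ℝ (fun y => (nullCoord ε (cplx (A y) (B y)))⁻¹) y X • cplx (A y) (B y) := by
  filter_upwards [(h.coneSection_gaussCoord h0).eventually_nhds,
    eventually_contDiffAt (h.contDiffAt_gaussCoord h0),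
    eventually_contDiffAt (h.contDiffAt_inv_nullCoord h0),
    eventually_contDiffAt h.smooth, eventually_contDiffAt h.smooth_normal] with y hy h1 h2 h3 h4 X
  have e := hasDerivAt_line_unique hy
    (hasDerivAt_coneSection ε (hasDerivAt_comp_line h1 X))
    ((hasDerivAt_comp_line h2 X).smul
      (hasDerivAt_cplx (hasDerivAt_comp_line h3 X) (hasDerivAt_comp_line h4 X)))
  simpa using e

lemma coneHess_gaussCoord (X Y : E) :
    coneHess ε (fderiv ℝ (gaussCoord ε A B) x X) (fderiv ℝ (gaussCoord ε A B) x Y) +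
      coneTangent ε (gaussCoord ε A B x) (fderiv ℝ (fderiv ℝ (gaussCoord ε A B)) x X Y) =
    (nullCoord ε (cplx (A x) (B x)))⁻¹ •
        cplx (fderiv ℝ (fderiv ℝ A) x X Y) (fderiv ℝ (fderiv ℝ B) x X Y) +
      fderiv ℝ (fun y => (nullCoord ε (cplx (A y) (B y)))⁻¹) x X •
        cplx (fderiv ℝ A x Y) (fderiv ℝ B x Y) +
      (fderiv ℝ (fun y => (nullCoord ε (cplx (A y) (B y)))⁻¹) x Y •
        cplx (fderiv ℝ A x X) (fderiv ℝ B x X) +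
      fderiv ℝ (fderiv ℝ (fun y => (nullCoord ε (cplx (A y) (B y)))⁻¹)) x X Y •
        cplx (A x) (B x)) := by
  have hF := h.contDiffAt_gaussCoord h0
  have hu := h.contDiffAt_inv_nullCoord h0
  have dF := (eventually_contDiffAt hF).self_of_nhds
  have du := (eventually_contDiffAt hu).self_of_nhds
  have dA := (eventually_contDiffAt h.smooth).self_of_nhds
  have dB := (eventually_contDiffAt h.smooth_normal).self_of_nhds
  have e := hasDerivAt_line_unique ((h.coneTangent_gaussCoord h0).mono fun y hy => hy Y)
    (hasDerivAt_coneTangent ε (hasDerivAt_comp_line dF X) (hasDerivAt_fderiv_line hF X Y))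
    (((hasDerivAt_comp_line du X).smul (hasDerivAt_cplx (hasDerivAt_fderiv_line h.smooth X Y)
        (hasDerivAt_fderiv_line h.smooth_normal X Y))).add
      ((hasDerivAt_fderiv_line hu X Y).smul
      (hasDerivAt_cplx (hasDerivAt_comp_line dA X) (hasDerivAt_comp_line dB X))))
  simpa using e

lemma herm_coneSection_gaussCoord :
    (herm (coneSection ε (gaussCoord ε A B x)) (coneSection ε (gaussCoord ε A B x))).re < 0 := by
  have h1 : 0 < ‖(nullCoord ε (cplx (A x) (B x)))⁻¹‖ ^ 2 :=
    pow_pos (norm_pos_iff.2 (inv_ne_zero h0)) 2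
  rw [(h.coneSection_gaussCoord h0).self_of_nhds, herm_smul_smul_re, h.herm_cplx_self.self_of_nhds,
    Complex.neg_re, Complex.re_ofNat]
  linarith

/-- By scaling invariance the product may be computed at `A + i B`. There the second vector is
horizontal up to a vertical term, so `v` need not be, and the half comes from `-(z, z) = 2`. -/
lemma hopfHerm_coneTangent_right (v : Fin (n + 2) → ℂ) (X : E) :
    hopfHerm (coneSection ε (gaussCoord ε A B x)) ((nullCoord ε (cplx (A x) (B x)))⁻¹ • v)
      (coneTangent ε (gaussCoord ε A B x) (fderiv ℝ (gaussCoord ε A B) x X)) =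
    herm v (cplx (fderiv ℝ A x X) (fderiv ℝ B x X)) / 2 := by
  have hs := h.herm_cplx_self.self_of_nhds
  have ho := h.herm_cplx_fderiv.self_of_nhds X
  have ho' : herm (cplx (A x) (B x)) (cplx (fderiv ℝ A x X) (fderiv ℝ B x X)) = 0 := by
    rw [← herm_conj, ho, map_zero]
  have hu := inv_ne_zero h0
  rw [(h.coneTangent_gaussCoord h0).self_of_nhds X, (h.coneSection_gaussCoord h0).self_of_nhds,
    hopfHerm_add_right, hopfHerm_smul_smul_smul _ _ _ hu]
  rw [hopfHerm, ho', hs]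
  simp only [hopfHerm, herm_smul_left, herm_smul_right, hs]
  have hc' : (starRingEnd ℂ) (nullCoord ε (cplx (A x) (B x))) ≠ 0 := (map_ne_zero _).2 h0
  simp only [map_inv₀]
  field_simp
  ring

lemma coordHerm_gaussCoord (X Y : E) :
    coordHerm ε (gaussCoord ε A B x) (fderiv ℝ (gaussCoord ε A B) x X)
      (fderiv ℝ (gaussCoord ε A B) x Y) =
    (((realForm n (fderiv ℝ A x X) (fderiv ℝ A x Y) +
        realForm n (fderiv ℝ B x X) (fderiv ℝ B x Y)) / 2 : ℝ) : ℂ) := by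
  have hu := inv_ne_zero h0
  have hs := herm_self_ne_zero (h.herm_coneSection_gaussCoord h0)
  rw [(h.coneSection_gaussCoord h0).self_of_nhds] at hs
  have key := h.hopfHerm_coneTangent_right h0 (cplx (fderiv ℝ A x X) (fderiv ℝ B x X)) Y
  rw [h.herm_cplx_fderiv_fderiv] at key
  rw [Complex.ofReal_div, Complex.ofReal_ofNat, ← key, coordHerm,
    (h.coneTangent_gaussCoord h0).self_of_nhds X]
  rw [(h.coneSection_gaussCoord h0).self_of_nhds, hopfHerm_add_left]
  have e : ∀ (c : ℂ) (z : Fin (n + 2) → ℂ), c • z =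
      (c * nullCoord ε (cplx (A x) (B x))) • (nullCoord ε (cplx (A x) (B x)))⁻¹ • z := by
    intro c z
    rw [smul_smul, mul_assoc, mul_inv_cancel₀ h0, mul_one]
  rw [e (fderiv ℝ _ x X) (cplx (A x) (B x)), hopfHerm_smul_left _ ((nullCoord ε (cplx (A x) (B x)))⁻¹ • _),
    hopfHerm_self_left hs, mul_zero, add_zero]

/-- The Gauss map is Lagrangian. -/
lemma coordMetric_gaussCoord (X Y : E) :
    coordMetric ε (gaussCoord ε A B x) (fderiv ℝ (gaussCoord ε A B) x X)
        (fderiv ℝ (gaussCoord ε A B) x Y) =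
      (realForm n (fderiv ℝ A x X) (fderiv ℝ A x Y) +
        realForm n (fderiv ℝ B x X) (fderiv ℝ B x Y)) / 2 ∧
    coordMetric ε (gaussCoord ε A B x) (fderiv ℝ (gaussCoord ε A B) x X)
        (Complex.I • fderiv ℝ (gaussCoord ε A B) x Y) = 0 := by
  have hn := h.herm_coneSection_gaussCoord h0
  have key := h.coordHerm_gaussCoord h0 X Y
  constructor
  · rw [coordMetric_apply ε hn, key, Complex.ofReal_re]
  · rw [coordMetric_apply ε hn, coordHerm, coneTangent_smul, hopfHerm_smul_right]
    rw [coordHerm] at key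
    rw [key, Complex.conj_I]
    simp

/-- With `u` the scaling factor and `z = A + i B`, differentiating `u z` twice yields the cross
terms `u_X z_Y` and `u_Y z_X`. The corrections in `liftedDeriv` cancel exactly these, and what
remains besides `u z_XY` is vertical. -/
lemma lifted_covariantHessian (X Y : E) : ∃ c : ℂ,
    coneTangent ε (gaussCoord ε A B x) (fderiv ℝ (fderiv ℝ (gaussCoord ε A B)) x X Y) +
      liftedDeriv ε (gaussCoord ε A B x) (fderiv ℝ (gaussCoord ε A B) x X)
        (fderiv ℝ (gaussCoord ε A B) x Y) =
    (nullCoord ε (cplx (A x) (B x)))⁻¹ •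
        cplx (fderiv ℝ (fderiv ℝ A) x X Y) (fderiv ℝ (fderiv ℝ B) x X Y) +
      c • coneSection ε (gaussCoord ε A B x) := by
  set N := nullCoord ε (cplx (A x) (B x)) with hN
  set u := fun y => (nullCoord ε (cplx (A y) (B y)))⁻¹ with hu
  have hs := h.herm_cplx_self.self_of_nhds
  have hN' : (starRingEnd ℂ) N ≠ 0 := (map_ne_zero _).2 h0
  have hθ : ∀ X, herm (coneTangent ε (gaussCoord ε A B x) (fderiv ℝ (gaussCoord ε A B) x X))
      (coneSection ε (gaussCoord ε A B x)) /
      herm (coneSection ε (gaussCoord ε A B x)) (coneSection ε (gaussCoord ε A B x)) =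
      fderiv ℝ u x X * N := by
    intro X
    rw [(h.coneTangent_gaussCoord h0).self_of_nhds X, (h.coneSection_gaussCoord h0).self_of_nhds]
    simp only [herm_add_left, herm_smul_left, herm_smul_right, hs,
      h.herm_cplx_fderiv.self_of_nhds X, map_inv₀, ← hN, ← hu]
    field_simp
    ring
  -- The remainder is `u_XY z` minus `u_X u_Y N z` from each of the two corrections, where `u =
  -- N⁻¹`; written as a multiple of `u z` it acquires one more factor `N`.
  refine ⟨fderiv ℝ (fderiv ℝ u) x X Y * N - 2 * fderiv ℝ u x X * fderiv ℝ u x Y * N ^ 2, ?_⟩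
  have e := h.coneHess_gaussCoord h0 X Y
  rw [liftedDeriv, hθ, hθ, (h.coneTangent_gaussCoord h0).self_of_nhds X,
    (h.coneTangent_gaussCoord h0).self_of_nhds Y, (h.coneSection_gaussCoord h0).self_of_nhds]
  rw [← hN, ← hu] at e ⊢
  have e' : ∀ a b c d : Fin (n + 2) → ℂ, a + (b - c - d) = b + a - c - d := by
    intros; abel
  rw [e', e]
  funext i
  simp only [Pi.add_apply, Pi.sub_apply, Pi.smul_apply, smul_eq_mul]
  field_simp
  ring

/-- A factor `i` in the second argument turns the real part of the Hermitian product into the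
imaginary part, which is the cubic form; the vertical remainder drops out. -/
lemma coordMetric_covariantHessian
    (hpos : ∀ ξ, ξ ≠ 0 → 0 < coordMetric ε (gaussCoord ε A B x) ξ ξ) (X Y W : E) :
    coordMetric ε (gaussCoord ε A B x)
      (fderiv ℝ (fderiv ℝ (gaussCoord ε A B)) x X Y +
        christoffel ε (gaussCoord ε A B x) (fderiv ℝ (gaussCoord ε A B) x X)
          (fderiv ℝ (gaussCoord ε A B) x Y))
      (Complex.I • fderiv ℝ (gaussCoord ε A B) x W) = cubicForm A B x X Y W := by
  have hn := h.herm_coneSection_gaussCoord h0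
  rw [map_add, LinearMap.add_apply, christoffel_spec ε hn hpos, coordMetric_apply ε hn, coordHerm,
    ← Complex.add_re, ← hopfHerm_add_left]
  obtain ⟨c, hc⟩ := h.lifted_covariantHessian h0 X Y
  rw [hc, hopfHerm_add_left, hopfHerm_smul_left _ (coneSection ε _),
    hopfHerm_self_left (herm_self_ne_zero hn), mul_zero, add_zero, coneTangent_smul,
    hopfHerm_smul_right, h.hopfHerm_coneTangent_right h0, herm_cplx, cubicForm, Complex.conj_I]
  simp

/-- The image `L` of the differential is Lagrangian, so `L` and `i L` are orthogonal, and `i` is an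
isometry. The square is therefore the sum of two values of the form `(I + III) / 2`. -/
lemma coordMetric_gaussCoord_pos
    (hsp : ∀ X, 0 ≤ realForm n (fderiv ℝ B x X) (fderiv ℝ B x X)) (X Y : E) (hX : X ≠ 0 ∨ Y ≠ 0) :
    0 < coordMetric ε (gaussCoord ε A B x)
      (fderiv ℝ (gaussCoord ε A B) x X + Complex.I • fderiv ℝ (gaussCoord ε A B) x Y)
      (fderiv ℝ (gaussCoord ε A B) x X + Complex.I • fderiv ℝ (gaussCoord ε A B) x Y) := by
  have hn := h.herm_coneSection_gaussCoord h0
  have hA : ∀ X, 0 ≤ realForm n (fderiv ℝ A x X) (fderiv ℝ A x X) := by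
    intro X
    by_cases hX : X = 0
    · simp [hX]
    · exact (h.spacelike.self_of_nhds X hX).le
  have hI : ∀ ξ : Fin n → ℂ, Complex.I • Complex.I • ξ = -ξ := by
    intro ξ; rw [smul_smul, Complex.I_mul_I, neg_one_smul]
  simp only [map_add, LinearMap.add_apply]
  rw [coordMetric_comm ε hn (Complex.I • _) (fderiv ℝ (gaussCoord ε A B) x X),
    (h.coordMetric_gaussCoord h0 X Y).2, coordMetric_I_left ε hn, hI, map_neg, neg_neg,
    (h.coordMetric_gaussCoord h0 X X).1, (h.coordMetric_gaussCoord h0 Y Y).1]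
  rcases hX with hX | hX
  · linarith [h.spacelike.self_of_nhds X hX, hsp X, hsp Y, hA Y]
  · linarith [h.spacelike.self_of_nhds Y hX, hsp X, hsp Y, hA X]

end IsLocalFront

end Local

/-! ### Matrices -/

section MatrixLemmas

open Matrix

variable {n : ℕ}

/-- Jacobi's formula. -/
lemma hasDerivAt_det {K : ℝ → Matrix (Fin n) (Fin n) ℂ} {K' : Matrix (Fin n) (Fin n) ℂ} {t : ℝ}
    (hK : ∀ i j, HasDerivAt (fun s => K s i j) (K' i j) t) :
    HasDerivAt (fun s => (K s).det) ((adjugate (K t) * K').trace) t := by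
  -- The determinant is multilinear in the rows, so its derivative is a sum of determinants with one
  -- row replaced, which Cramer's rule expresses through the adjugate.
  let f : ContinuousMultilinearMap ℂ (fun _ : Fin n => Fin n → ℂ) ℂ :=
    { (detRowAlternating (R := ℂ) (n := Fin n)).toMultilinearMap with
      cont := Continuous.matrix_det continuous_id }
  have hK' : HasDerivAt (fun s i j => K s i j) (fun i j => K' i j) t :=
    hasDerivAt_pi.2 fun i => hasDerivAt_pi.2 fun j => hK i j
  have h := ((f.hasFDerivAt (fun i j => K t i j)).restrictScalars ℝ).comp_hasDerivAt t hK'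
  refine h.congr_deriv ?_
  change f.linearDeriv _ _ = _
  rw [ContinuousMultilinearMap.linearDeriv_apply, trace_mul_comm, trace]
  refine Finset.sum_congr rfl fun i _ => ?_
  have e : f (Function.update (fun i j => K t i j) i (K' i)) = ((K t).updateRow i (K' i)).det := rfl
  change f (Function.update (fun i j => K t i j) i (K' i)) = _
  rw [e, ← cramer_transpose_apply, cramer_eq_adjugate_mulVec, ← adjugate_transpose, mulVec_transpose,
    diag_apply, mul_apply]
  rfl

lemma hasDerivAt_det_of_ne_zero {K : ℝ → Matrix (Fin n) (Fin n) ℂ} {K' : Matrix (Fin n) (Fin n) ℂ}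
    {t : ℝ} (hK : ∀ i j, HasDerivAt (fun s => K s i j) (K' i j) t) (h0 : (K t).det ≠ 0) :
    HasDerivAt (fun s => (K s).det) ((K t).det * ((K t)⁻¹ * K').trace) t := by
  refine (hasDerivAt_det hK).congr_deriv ?_
  rw [inv_def, smul_mul_assoc, trace_smul, smul_eq_mul, ← mul_assoc,
    Ring.mul_inverse_cancel _ (isUnit_iff_ne_zero.2 h0), one_mul]

/-- A real matrix regarded as a complex matrix. -/
noncomputable abbrev toC (A : Matrix (Fin n) (Fin n) ℝ) : Matrix (Fin n) (Fin n) ℂ :=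
  A.map (algebraMap ℝ ℂ)

lemma toC_mul (A B : Matrix (Fin n) (Fin n) ℝ) : toC (A * B) = toC A * toC B :=
  Matrix.map_mul

lemma toC_add (A B : Matrix (Fin n) (Fin n) ℝ) : toC (A + B) = toC A + toC B :=
  Matrix.map_add _ (map_add _) _ _

lemma toC_sub (A B : Matrix (Fin n) (Fin n) ℝ) : toC (A - B) = toC A - toC B :=
  Matrix.map_sub _ (map_sub _) _ _

lemma toC_one : toC (1 : Matrix (Fin n) (Fin n) ℝ) = 1 :=
  Matrix.map_one _ (map_zero _) (map_one _)

lemma det_toC (A : Matrix (Fin n) (Fin n) ℝ) : (toC A).det = (A.det : ℂ) :=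
  ((algebraMap ℝ ℂ).map_det A).symm

lemma trace_toC (A : Matrix (Fin n) (Fin n) ℝ) : (toC A).trace = (A.trace : ℂ) := by
  simp [trace]

/-- For `c ≠ 0` one has `1 + c S = -c (-c⁻¹ - S)`, so this is the characteristic polynomial
evaluated at `-c⁻¹`. -/
lemma det_one_add_smul_toC {S : Matrix (Fin n) (Fin n) ℝ} {lam : Fin n → ℝ}
    (hS : S.charpoly = ∏ j, (Polynomial.X - Polynomial.C (lam j))) (c : ℂ) :
    (1 + c • toC S).det = ∏ j, (1 + c * lam j) := by
  by_cases hc : c = 0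
  · simp [hc]
  have h1 : (toC S).charpoly = ∏ j, (Polynomial.X - Polynomial.C (lam j : ℂ)) := by
    rw [Matrix.charpoly_map, hS, Polynomial.map_prod]
    simp
  have h2 := congrArg (Polynomial.eval (-c⁻¹)) h1
  rw [eval_charpoly, Polynomial.eval_prod] at h2
  have h3 : 1 + c • toC S = (-c) • (scalar (Fin n) (-c⁻¹) - toC S) := by
    ext i j
    by_cases hij : i = j
    · subst hij; simp; field_simp; ring
    · simp [hij]
  have h4 : (-c) ^ n = ∏ _j : Fin n, (-c) := by simp
  rw [h3, det_smul, h2, Fintype.card_fin, h4, ← Finset.prod_mul_distrib]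
  refine Finset.prod_congr rfl fun j _ => ?_
  simp only [Polynomial.eval_sub, Polynomial.eval_X, Polynomial.eval_C]
  field_simp
  ring

lemma sub_smul_mul_add_smul {A : Type*} [Ring A] [Algebra ℂ A] (r q p h : A) :
    (r - Complex.I • q) * (p + Complex.I • h) =
      (r * p + q * h) + Complex.I • (r * h - q * p) := by
  simp only [sub_mul, mul_add, smul_mul_assoc, mul_smul_comm, smul_smul, Complex.I_mul_I, neg_smul,
    one_smul, smul_sub]
  abel

/-- The noncommutative form of `(1 + i s) (1 - i s) = 1 + s²`; it exhibits the inverse of `I + i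
II`. -/
lemma conj_mul_eq {A : Type*} [Ring A] [Algebra ℂ A] (g s r : A) :
    (g + Complex.I • (g * s)) * (r - Complex.I • (s * r)) = g * (1 + s * s) * r := by
  simp only [mul_sub, add_mul, mul_add, smul_mul_assoc, mul_smul_comm, smul_smul, Complex.I_mul_I,
    neg_smul, one_smul, smul_add, mul_one, mul_assoc]
  abel

open scoped MatrixOrder in
/-- A matrix which is symmetric with respect to an inner product is diagonalizable. -/
lemma exists_charpoly_eq_prod {G S : Matrix (Fin n) (Fin n) ℝ} (hG : G.PosDef)
    (hS : (G * S)ᵀ = G * S) :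
    ∃ lam : Fin n → ℝ, S.charpoly = ∏ j, (Polynomial.X - Polynomial.C (lam j)) := by
  -- With `G = Uᵀ U`, the matrix `U S U⁻¹` is symmetric and has the same characteristic polynomial
  -- as `S`.
  obtain ⟨P, hP, rfl⟩ := CStarAlgebra.isStrictlyPositive_iff_eq_star_mul_self.1
    hG.isStrictlyPositive
  obtain ⟨U, rfl⟩ := hP
  have hs : (star (U : Matrix (Fin n) (Fin n) ℝ)) = (U : Matrix (Fin n) (Fin n) ℝ)ᵀ :=
    conjTranspose_eq_transpose_of_trivial _
  rw [hs] at hS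
  have hUi : (U : Matrix (Fin n) (Fin n) ℝ) * ((U⁻¹ : (Matrix (Fin n) (Fin n) ℝ)ˣ) :
      Matrix (Fin n) (Fin n) ℝ) = 1 := U.mul_inv
  set V := ((U⁻¹ : (Matrix (Fin n) (Fin n) ℝ)ˣ) : Matrix (Fin n) (Fin n) ℝ)
  have hVt : Vᵀ * (U : Matrix (Fin n) (Fin n) ℝ)ᵀ = 1 := by
    rw [← transpose_mul, hUi, transpose_one]
  have hH : ((U : Matrix (Fin n) (Fin n) ℝ) * S * V).IsHermitian := by
    rw [IsHermitian, conjTranspose_eq_transpose_of_trivial]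
    have e1 : (U : Matrix (Fin n) (Fin n) ℝ) * S * V =
        Vᵀ * ((U : Matrix (Fin n) (Fin n) ℝ)ᵀ * (U : Matrix (Fin n) (Fin n) ℝ) * S) * V := by
      simp only [← mul_assoc, hVt, one_mul]
    rw [e1, transpose_mul, transpose_mul, transpose_transpose, hS, mul_assoc, mul_assoc, mul_assoc,
      mul_assoc, mul_assoc]
  refine ⟨hH.eigenvalues, ?_⟩
  rw [← charpoly_units_conj U S, ← coe_units_inv]
  exact hH.charpoly_eq

/-- The matrix identity behind the formula for the differential of the Lagrangian angle. -/
lemma im_trace_inv_mul {G S P C Γ : Matrix (Fin n) (Fin n) ℝ} (hG : Gᵀ = G)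
    (hGS : (G * S)ᵀ = G * S) (hΓ : (2 : ℝ) • Γ = G + Sᵀ * G * S) (hΓ0 : Γ.det ≠ 0) :
    (toC G + Complex.I • toC (G * S)).det ≠ 0 ∧
    ((toC G + Complex.I • toC (G * S))⁻¹ * (toC (P + Pᵀ) + Complex.I •
      toC (P * S + (P * S)ᵀ - (2 : ℝ) • C))).trace.im = -(Γ⁻¹ * C).trace := by
  have hu : IsUnit Γ.det := isUnit_iff_ne_zero.2 hΓ0
  -- `R` is the inverse of `2 Γ = G (1 + S * S)`, so that `R - i S R` inverts `G + i G S`.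
  set R := (1 / 2 : ℝ) • Γ⁻¹ with hR
  have hSG : Sᵀ * G = G * S := by rw [← hGS, transpose_mul, hG]
  have hΓ2 : (2 : ℝ) • Γ = G * (1 + S * S) := by
    rw [hΓ, hSG, mul_add, mul_one, mul_assoc]
  have hΓR : (2 : ℝ) • Γ * R = 1 := by
    rw [hR, smul_mul_smul_comm, mul_nonsing_inv _ hu]; norm_num
  have hRΓ : R * (2 : ℝ) • Γ = 1 := by
    rw [hR, smul_mul_smul_comm, nonsing_inv_mul _ hu]; norm_num
  have hΓt : Γᵀ = Γ := by
    have h1 : ((2 : ℝ) • Γ)ᵀ = (2 : ℝ) • Γ := by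
      rw [hΓ, transpose_add, transpose_mul, transpose_mul, transpose_transpose, hG, ← mul_assoc]
    rw [transpose_smul] at h1
    exact smul_right_injective _ (two_ne_zero (α := ℝ)) h1
  have hRt : Rᵀ = R := by rw [hR, transpose_smul, transpose_nonsing_inv, hΓt]
  have hΓS : (2 : ℝ) • Γ * S = Sᵀ * (2 : ℝ) • Γ := by
    rw [hΓ2]
    simp only [mul_add, add_mul, mul_one, hSG, mul_assoc]
    rw [← mul_assoc Sᵀ, hSG, mul_assoc]
  have hSR : S * R = R * Sᵀ := by
    calc S * R = R * ((2 : ℝ) • Γ * S) * R := by rw [← mul_assoc R, hRΓ, one_mul]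
      _ = R * Sᵀ * ((2 : ℝ) • Γ * R) := by rw [hΓS]; simp only [mul_assoc]
      _ = R * Sᵀ := by rw [hΓR, mul_one]
  have hSRt : (S * R)ᵀ = S * R := by rw [transpose_mul, hRt, hSR]
  have hinv : (toC G + Complex.I • toC (G * S)) * (toC R - Complex.I • toC (S * R)) = 1 := by
    have e := congrArg toC hΓR
    rw [hΓ2] at e
    simp only [toC_add, toC_mul, toC_one] at e
    rw [toC_mul G S, toC_mul S R, conj_mul_eq, e]
  have hne : (toC G + Complex.I • toC (G * S)).det ≠ 0 := by
    intro h0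
    have := congrArg det hinv
    rw [det_mul, h0, zero_mul, det_one] at this
    exact zero_ne_one this
  refine ⟨hne, ?_⟩
  rw [inv_eq_right_inv hinv]
  have h1 : (toC R - Complex.I • toC (S * R)) * (toC (P + Pᵀ) + Complex.I •
      toC (P * S + (P * S)ᵀ - (2 : ℝ) • C)) =
      toC (R * (P + Pᵀ) + S * R * (P * S + (P * S)ᵀ - (2 : ℝ) • C)) +
      Complex.I • toC (R * (P * S + (P * S)ᵀ - (2 : ℝ) • C) - S * R * (P + Pᵀ)) := by
    rw [sub_smul_mul_add_smul, toC_add (R * _), toC_sub (R * _), toC_mul R, toC_mul (S * R),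
      toC_mul R, toC_mul (S * R)]
  rw [h1, trace_add, trace_smul, trace_toC, trace_toC, smul_eq_mul, Complex.add_im,
    Complex.ofReal_im, Complex.I_mul_im, Complex.ofReal_re, zero_add]
  -- All the traces containing `P` coincide, so they cancel in the difference and only the term with
  -- `C` survives.
  have t1 : (S * R * P).trace = (R * (P * S)).trace := by
    rw [mul_assoc, trace_mul_comm, mul_assoc]
  have t2 : (S * R * Pᵀ).trace = (S * R * P).trace := by
    rw [← trace_transpose, transpose_mul, transpose_transpose, hSRt, trace_mul_comm]
  have t3 : (R * (P * S)ᵀ).trace = (R * (P * S)).trace := by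
    rw [← trace_transpose, transpose_mul, transpose_transpose, hRt, trace_mul_comm]
  have t4 : (2 : ℝ) * (R * C).trace = (Γ⁻¹ * C).trace := by
    rw [hR, smul_mul_assoc, trace_smul, smul_eq_mul]; ring
  simp only [mul_add, mul_sub, trace_add, trace_sub, trace_smul, mul_smul_comm, smul_eq_mul, t1, t2,
    t3]
  linarith

end MatrixLemmas

/-! ### The shape operator at a point -/

section Frame

open Matrix

variable {n : ℕ}

lemma sum_smul_stdVec (X : EuclideanSpace ℝ (Fin n)) : ∑ i, X i • stdVec i = X := by
  ext j
  simp [stdVec, Pi.single_apply]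

lemma apply_gram {F : Type*} [AddCommGroup F] [Module ℝ F] (B : LinearMap.BilinForm ℝ F)
    (T : EuclideanSpace ℝ (Fin n) →ₗ[ℝ] F) (X Y : EuclideanSpace ℝ (Fin n)) :
    B (T X) (T Y) = ∑ i, ∑ j, X i * Y j * gram B T i j := by
  conv_lhs => rw [← sum_smul_stdVec X, ← sum_smul_stdVec Y]
  simp only [map_sum, map_smul, LinearMap.sum_apply, LinearMap.smul_apply, smul_eq_mul, gram,
    of_apply, Finset.mul_sum]
  rw [Finset.sum_comm]
  exact Finset.sum_congr rfl fun i _ => Finset.sum_congr rfl fun j _ => by ring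

lemma gram_posDef {F : Type*} [AddCommGroup F] [Module ℝ F] {B : LinearMap.BilinForm ℝ F}
    {T : EuclideanSpace ℝ (Fin n) →ₗ[ℝ] F} (hs : ∀ X Y, B (T X) (T Y) = B (T Y) (T X))
    (hpos : ∀ X, X ≠ 0 → 0 < B (T X) (T X)) : (gram B T).PosDef := by
  refine PosDef.of_dotProduct_mulVec_pos ?_ fun x hx => ?_
  · rw [IsHermitian, conjTranspose_eq_transpose_of_trivial]
    ext i j
    exact hs _ _
  · have h := hpos (WithLp.toLp 2 x) (by simpa using hx)
    rw [apply_gram] at h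
    refine lt_of_lt_of_eq h ?_
    simp only [dotProduct, mulVec, Finset.mul_sum, star_trivial]
    exact Finset.sum_congr rfl fun i _ => Finset.sum_congr rfl fun j _ => by ring

lemma tangentialPart_apply {F : Type*} [AddCommGroup F] [Module ℝ F] {B : LinearMap.BilinForm ℝ F}
    {T : EuclideanSpace ℝ (Fin n) →ₗ[ℝ] F} (hs : ∀ X Y, B (T X) (T Y) = B (T Y) (T X))
    (hpos : ∀ X, X ≠ 0 → 0 < B (T X) (T X)) (X : EuclideanSpace ℝ (Fin n)) :
    tangentialPart B T (T X) = X := by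
  have hu : IsUnit (gram B T).det :=
    isUnit_iff_ne_zero.2 (gram_posDef hs hpos).det_pos.ne'
  ext k
  have h1 : ∀ j, B (T X) (T (stdVec j)) = ∑ l, gram B T j l * X l := by
    intro j
    conv_lhs => rw [← sum_smul_stdVec X]
    simp only [map_sum, map_smul, LinearMap.sum_apply, LinearMap.smul_apply, smul_eq_mul]
    refine Finset.sum_congr rfl fun l _ => ?_
    rw [hs, mul_comm]
    rfl
  have h2 : ((gram B T)⁻¹ *ᵥ (gram B T *ᵥ X.ofLp)) k = X k := by
    rw [mulVec_mulVec, nonsing_inv_mul _ hu, one_mulVec]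
  rw [← h2]
  simp only [tangentialPart, LinearMap.sum_apply, LinearMap.smul_apply, LinearMap.smulRight_apply,
    LinearMap.BilinForm.flip_apply, h1]
  simp [stdVec, mulVec, dotProduct, Pi.single_apply]

/-- The linear algebra of a spacelike immersion at a point: `T` and `D` are the differentials of the
immersion `a` and of the unit normal `b`. -/
structure IsFrame (a b : Fin (n + 2) → ℝ)
    (T D : EuclideanSpace ℝ (Fin n) →ₗ[ℝ] (Fin (n + 2) → ℝ)) : Prop where
  mem : realForm n a a = -1
  unit : realForm n b b = -1
  tangent : realForm n a b = 0
  left : ∀ X, realForm n (T X) a = 0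
  right : ∀ X, realForm n (T X) b = 0
  left_normal : ∀ X, realForm n (D X) a = 0
  right_normal : ∀ X, realForm n (D X) b = 0
  comm : ∀ X Y, realForm n (T X) (D Y) = realForm n (D X) (T Y)
  pos : ∀ X, X ≠ 0 → 0 < realForm n (T X) (T X)

/-- `-T⁻¹ D`, the shape operator. -/
noncomputable def shapeOf (T D : EuclideanSpace ℝ (Fin n) →ₗ[ℝ] (Fin (n + 2) → ℝ)) :
    Module.End ℝ (EuclideanSpace ℝ (Fin n)) :=
  -(tangentialPart (realForm n) T ∘ₗ D)

/-- The standard basis, consisting of the vectors `stdVec i`. -/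
noncomputable def stdBasis (n : ℕ) : Module.Basis (Fin n) ℝ (EuclideanSpace ℝ (Fin n)) :=
  (EuclideanSpace.basisFun (Fin n) ℝ).toBasis

/-- The matrix of the shape operator. -/
noncomputable def shapeMatrix (T D : EuclideanSpace ℝ (Fin n) →ₗ[ℝ] (Fin (n + 2) → ℝ)) :
    Matrix (Fin n) (Fin n) ℝ :=
  LinearMap.toMatrix (stdBasis n) (stdBasis n) (shapeOf T D)

/-- The matrix of the (scalar) second fundamental form. -/
noncomputable def secondMatrix (T D : EuclideanSpace ℝ (Fin n) →ₗ[ℝ] (Fin (n + 2) → ℝ)) :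
    Matrix (Fin n) (Fin n) ℝ :=
  Matrix.of fun i j => -realForm n (T (stdVec i)) (D (stdVec j))

namespace IsFrame

variable {a b : Fin (n + 2) → ℝ} {T D : EuclideanSpace ℝ (Fin n) →ₗ[ℝ] (Fin (n + 2) → ℝ)}
  (h : IsFrame a b T D)
include h

/-- The vectors `a`, `b` and the range of `T` are independent, hence span `ℝ^{n+2}` by dimension.
Pairing with the orthogonal unit vectors `a` and `b` then detects the components outside the range
of `T`. -/
lemma exists_eq (v : Fin (n + 2) → ℝ) (ha : realForm n v a = 0) (hb : realForm n v b = 0) :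
    ∃ X, T X = v := by
  have hba : realForm n b a = 0 := by rw [realForm_comm, h.tangent]
  let L : (ℝ × ℝ) × EuclideanSpace ℝ (Fin n) →ₗ[ℝ] (Fin (n + 2) → ℝ) :=
    LinearMap.coprod (LinearMap.coprod (LinearMap.toSpanSingleton ℝ _ a)
      (LinearMap.toSpanSingleton ℝ _ b)) T
  have hL : ∀ s t X, L ((s, t), X) = s • a + t • b + T X := fun s t X => rfl
  have hpair : ∀ s t X, realForm n (L ((s, t), X)) a = -s ∧ realForm n (L ((s, t), X)) b = -t := by
    intro s t X
    simp only [hL, map_add, LinearMap.add_apply, map_smul, LinearMap.smul_apply, h.mem, h.unit,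
      h.tangent, hba, h.left, h.right, smul_eq_mul]
    constructor <;> ring
  have hinj : Function.Injective L := by
    rw [injective_iff_map_eq_zero]
    rintro ⟨⟨s, t⟩, X⟩ h0
    have h1 := hpair s t X
    rw [h0, map_zero, LinearMap.zero_apply, LinearMap.zero_apply] at h1
    obtain rfl : s = 0 := by linarith [h1.1]
    obtain rfl : t = 0 := by linarith [h1.2]
    rw [hL, zero_smul, zero_smul, zero_add, zero_add] at h0
    have hX : X = 0 := by
      by_contra hX
      have := h.pos X hX
      rw [h0, map_zero] at this
      exact lt_irrefl _ this
    rw [hX]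
    rfl
  have hdim : Module.finrank ℝ ((ℝ × ℝ) × EuclideanSpace ℝ (Fin n)) =
      Module.finrank ℝ (Fin (n + 2) → ℝ) := by
    simp; omega
  obtain ⟨⟨⟨s, t⟩, X⟩, hx⟩ :=
    (LinearMap.injective_iff_surjective_of_finrank_eq_finrank hdim).1 hinj v
  have h1 := hpair s t X
  rw [hx, ha, hb] at h1
  obtain rfl : s = 0 := by linarith [h1.1]
  obtain rfl : t = 0 := by linarith [h1.2]
  refine ⟨X, ?_⟩
  rw [← hx, hL, zero_smul, zero_smul, zero_add, zero_add]

omit h in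
lemma symm_tangent (X Y : EuclideanSpace ℝ (Fin n)) :
    realForm n (T X) (T Y) = realForm n (T Y) (T X) := realForm_comm _ _

/-- The Weingarten equation without normal component: `D X` already lies in the range of `T`, so the
projection loses nothing. -/
lemma apply_shapeOf (X : EuclideanSpace ℝ (Fin n)) : T (shapeOf T D X) = -D X := by
  obtain ⟨Y, hY⟩ := h.exists_eq (D X) (h.left_normal X) (h.right_normal X)
  rw [shapeOf, LinearMap.neg_apply, LinearMap.comp_apply, ← hY,
    tangentialPart_apply symm_tangent h.pos, map_neg]

lemma injective : Function.Injective T := by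
  rw [injective_iff_map_eq_zero]
  intro X h0
  by_contra hX
  have := h.pos X hX
  rw [h0, map_zero] at this
  exact lt_irrefl _ this

/-- The vector `D X` has the form `T Y`, so it is spacelike or zero. -/
lemma normal_nonneg (X : EuclideanSpace ℝ (Fin n)) : 0 ≤ realForm n (D X) (D X) := by
  obtain ⟨Y, hY⟩ := h.exists_eq (D X) (h.left_normal X) (h.right_normal X)
  rw [← hY]
  by_cases h0 : Y = 0
  · simp [h0]
  · exact (h.pos Y h0).le

lemma posDef : (gram (realForm n) T).PosDef := gram_posDef symm_tangent h.pos

omit h in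
lemma shapeOf_stdVec_apply (l j : Fin n) :
    shapeOf T D (stdVec j) l = shapeMatrix T D l j := by
  rw [shapeMatrix, LinearMap.toMatrix_apply]
  simp [stdBasis, stdVec]

/-- The vector `D (stdVec j)` in terms of the shape operator. -/
lemma apply_stdVec (j : Fin n) :
    D (stdVec j) = -∑ l, shapeMatrix T D l j • T (stdVec l) := by
  have e : shapeOf T D (stdVec j) = ∑ l, shapeMatrix T D l j • stdVec l := by
    rw [← sum_smul_stdVec (shapeOf T D (stdVec j))]
    exact Finset.sum_congr rfl fun l _ => by rw [shapeOf_stdVec_apply]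
  have := h.apply_shapeOf (stdVec j)
  rw [e, map_sum] at this
  simp only [map_smul] at this
  rw [this, neg_neg]

lemma gram_mul_shapeMatrix : gram (realForm n) T * shapeMatrix T D = secondMatrix T D := by
  ext i j
  rw [secondMatrix, of_apply, h.apply_stdVec, map_neg, neg_neg, map_sum, mul_apply]
  refine Finset.sum_congr rfl fun l _ => ?_
  rw [map_smul, smul_eq_mul, mul_comm]
  rfl

lemma gram_mul_shapeMatrix_transpose :
    (gram (realForm n) T * shapeMatrix T D)ᵀ = gram (realForm n) T * shapeMatrix T D := by
  rw [h.gram_mul_shapeMatrix]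
  ext i j
  simp only [secondMatrix, transpose_apply, of_apply, h.comm (stdVec j)]
  rw [realForm_comm]

lemma gram_normal : gram (realForm n) D =
    (shapeMatrix T D)ᵀ * gram (realForm n) T * shapeMatrix T D := by
  ext i j
  have e : ∀ X, D X = -T (shapeOf T D X) := fun X => by rw [h.apply_shapeOf, neg_neg]
  rw [gram, of_apply, e, e, map_neg, map_neg, LinearMap.neg_apply, neg_neg, apply_gram, mul_assoc,
    mul_apply]
  refine Finset.sum_congr rfl fun l _ => ?_
  rw [mul_apply, Finset.mul_sum]
  refine Finset.sum_congr rfl fun m _ => ?_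
  rw [shapeOf_stdVec_apply, shapeOf_stdVec_apply, transpose_apply]
  ring

lemma exists_charpoly_shapeOf : ∃ lam : Fin n → ℝ,
    (shapeOf T D).charpoly = ∏ j, (Polynomial.X - Polynomial.C (lam j)) := by
  obtain ⟨lam, hl⟩ := exists_charpoly_eq_prod h.posDef h.gram_mul_shapeMatrix_transpose
  exact ⟨lam, by rw [← hl, shapeMatrix, LinearMap.charpoly_toMatrix]⟩

/-- Because `II = I S`, the quotient is `det (1 + c S)`. The left side involves no choice of
eigenvalues, which is what makes the product smooth. -/
lemma det_gram_add {lam : Fin n → ℝ}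
    (hl : (shapeOf T D).charpoly = ∏ j, (Polynomial.X - Polynomial.C (lam j))) (c : ℂ) :
    (toC (gram (realForm n) T) + c • toC (secondMatrix T D)).det / (gram (realForm n) T).det =
      ∏ j, (1 + c * lam j) := by
  have h1 : ((gram (realForm n) T).det : ℂ) ≠ 0 := by exact_mod_cast h.posDef.det_pos.ne'
  rw [← LinearMap.charpoly_toMatrix _ (stdBasis n)] at hl
  rw [← det_one_add_smul_toC hl, ← h.gram_mul_shapeMatrix, toC_mul, ← mul_smul_comm]
  conv_lhs => rw [← mul_one (toC (gram (realForm n) T)), mul_assoc, one_mul, ← mul_add, det_mul,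
    det_toC]
  rw [mul_div_cancel_left₀ _ h1]
  rfl

end IsFrame

end Frame

/-! ### The differential of the Lagrangian angle -/

section Angle

open Matrix

variable {n : ℕ} {A B : EuclideanSpace ℝ (Fin n) → Fin (n + 2) → ℝ} {x : EuclideanSpace ℝ (Fin n)}

/-- The differential of `f` at `y` as a linear map. -/
noncomputable abbrev diffAt {F : Type*} [NormedAddCommGroup F] [NormedSpace ℝ F]
    (f : EuclideanSpace ℝ (Fin n) → F) (y : EuclideanSpace ℝ (Fin n)) :
    EuclideanSpace ℝ (Fin n) →ₗ[ℝ] F :=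
  (fderiv ℝ f y).toLinearMap

/-- The determinant of `1 + i t S`, computed from the first and second fundamental forms. -/
noncomputable def angleDet (A B : EuclideanSpace ℝ (Fin n) → Fin (n + 2) → ℝ) (t : ℝ)
    (y : EuclideanSpace ℝ (Fin n)) : ℂ :=
  (toC (gram (realForm n) (diffAt A y)) + (Complex.I * t) •
    toC (secondMatrix (diffAt A y) (diffAt B y))).det /
    (toC (gram (realForm n) (diffAt A y))).det

lemma contDiffAt_realForm {u v : EuclideanSpace ℝ (Fin n) → Fin (n + 2) → ℝ}
    (hu : ContDiffAt ℝ ∞ u x) (hv : ContDiffAt ℝ ∞ v x) :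
    ContDiffAt ℝ ∞ (fun y => realForm n (u y) (v y)) x := by
  simp only [realForm, LinearMap.mk₂_apply]
  exact ContDiffAt.sum fun i _ =>
    (contDiffAt_const.mul (contDiffAt_pi.1 hu i)).mul (contDiffAt_pi.1 hv i)

lemma contDiffAt_det {K : EuclideanSpace ℝ (Fin n) → Matrix (Fin n) (Fin n) ℂ}
    (hK : ∀ i j, ContDiffAt ℝ ∞ (fun y => K y i j) x) : ContDiffAt ℝ ∞ (fun y => (K y).det) x := by
  simp only [det_apply]
  exact ContDiffAt.sum fun σ _ => (contDiffAt_prod fun i _ => hK _ _).const_smul _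

namespace IsLocalFront

variable (h : IsLocalFront A B x) {ε : ℤˣ}
include h

lemma eventually_isFrame : ∀ᶠ y in nhds x,
    IsFrame (A y) (B y) (diffAt A y) (diffAt B y) := by
  filter_upwards [h.mem, h.unit, h.tangent, h.normal, h.spacelike, h.realForm_fderiv_self,
    h.realForm_fderiv_normal_self, h.realForm_fderiv_normal, h.realForm_fderiv_fderiv_comm]
    with y h1 h2 h3 h4 h5 h6 h7 h8 h9
  exact ⟨h1, h2, h3, h6, h4, h8, h7, h9, h5⟩

lemma isFrame : IsFrame (A x) (B x) (diffAt A x) (diffAt B x) :=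
  h.eventually_isFrame.self_of_nhds

lemma contDiffAt_fderiv_apply (X : EuclideanSpace ℝ (Fin n)) :
    ContDiffAt ℝ ∞ (fun y => fderiv ℝ A y X) x ∧ ContDiffAt ℝ ∞ (fun y => fderiv ℝ B y X) x :=
  ⟨(h.smooth.fderiv_right (m := ∞) (by simp)).clm_apply contDiffAt_const,
    (h.smooth_normal.fderiv_right (m := ∞) (by simp)).clm_apply contDiffAt_const⟩

lemma contDiffAt_gram (i j : Fin n) :
    ContDiffAt ℝ ∞ (fun y => gram (realForm n) (diffAt A y) i j) x :=
  contDiffAt_realForm (h.contDiffAt_fderiv_apply _).1 (h.contDiffAt_fderiv_apply _).1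

lemma contDiffAt_secondMatrix (i j : Fin n) :
    ContDiffAt ℝ ∞ (fun y => secondMatrix (diffAt A y)
      (diffAt B y) i j) x :=
  (contDiffAt_realForm (h.contDiffAt_fderiv_apply _).1 (h.contDiffAt_fderiv_apply _).2).neg

lemma det_toC_gram_ne_zero : (toC (gram (realForm n) (diffAt A x))).det ≠ 0 := by
  rw [det_toC]
  exact_mod_cast h.isFrame.posDef.det_pos.ne'

lemma contDiffAt_angleDet (t : ℝ) : ContDiffAt ℝ ∞ (angleDet A B t) x := by
  have hG : ∀ i j, ContDiffAt ℝ ∞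
      (fun y => toC (gram (realForm n) (diffAt A y)) i j) x := fun i j =>
    Complex.ofRealCLM.contDiff.contDiffAt.comp x (h.contDiffAt_gram i j)
  have hS : ∀ i j, ContDiffAt ℝ ∞
      (fun y => toC (secondMatrix (diffAt A y) (diffAt B y)) i j) x := fun i j =>
    Complex.ofRealCLM.contDiff.contDiffAt.comp x (h.contDiffAt_secondMatrix i j)
  have h1 := (contDiffAt_det hG).inv h.det_toC_gram_ne_zero
  have h2 := contDiffAt_det fun i j => (hG i j).add
    (contDiffAt_const (c := Complex.I * (t : ℂ)).mul (hS i j))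
  exact h2.mul h1

/-- Joint continuity is what the compactness argument over `t ∈ [0, 1]` requires. -/
lemma continuousAt_angleDet (t : ℝ) :
    ContinuousAt (fun z : EuclideanSpace ℝ (Fin n) × ℝ => angleDet A B z.2 z.1) (x, t) := by
  have hG : ContinuousAt (fun z : EuclideanSpace ℝ (Fin n) × ℝ =>
      toC (gram (realForm n) (diffAt A z.1))) (x, t) := by
    refine continuousAt_pi.2 fun i => continuousAt_pi.2 fun j => ?_
    have h1 : ContinuousAt (fun z : EuclideanSpace ℝ (Fin n) × ℝ =>
        gram (realForm n) (diffAt A z.1) i j) (x, t) :=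
      ContinuousAt.comp (g := fun y => gram (realForm n) (diffAt A y) i j) (f := Prod.fst)
        (h.contDiffAt_gram i j).continuousAt continuousAt_fst
    exact Complex.continuous_ofReal.continuousAt.comp h1
  have hS : ContinuousAt (fun z : EuclideanSpace ℝ (Fin n) × ℝ =>
      toC (secondMatrix (diffAt A z.1) (diffAt B z.1))) (x, t) := by
    refine continuousAt_pi.2 fun i => continuousAt_pi.2 fun j => ?_
    have h1 : ContinuousAt (fun z : EuclideanSpace ℝ (Fin n) × ℝ =>
        secondMatrix (diffAt A z.1) (diffAt B z.1) i j) (x, t) :=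
      ContinuousAt.comp (g := fun y => secondMatrix (diffAt A y) (diffAt B y) i j)
        (f := Prod.fst) (h.contDiffAt_secondMatrix i j).continuousAt continuousAt_fst
    exact Complex.continuous_ofReal.continuousAt.comp h1
  have hd : Continuous fun K : Matrix (Fin n) (Fin n) ℂ => K.det :=
    Continuous.matrix_det continuous_id
  have hc : ContinuousAt (fun z : EuclideanSpace ℝ (Fin n) × ℝ => Complex.I * (z.2 : ℂ)) (x, t) := by
    fun_prop
  exact (hd.continuousAt.comp (hG.add (hc.smul hS))).div (hd.continuousAt.comp hG)
    h.det_toC_gram_ne_zero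

/-- The Gram matrix of the Gauss map in terms of the shape operator. -/
lemma gram_gaussCoord (h0 : nullCoord ε (cplx (A x) (B x)) ≠ 0) :
    (2 : ℝ) • gram (coordMetric ε (gaussCoord ε A B x))
      (diffAt (gaussCoord ε A B) x) =
    gram (realForm n) (diffAt A x) +
      gram (realForm n) (diffAt B x) := by
  ext i j
  have := (h.coordMetric_gaussCoord h0 (stdVec i) (stdVec j)).1
  simp only [gram, Matrix.smul_apply, of_apply, Matrix.add_apply, smul_eq_mul, ContinuousLinearMap.coe_coe, this]
  ring

/-- The matrix of the second fundamental form of the Gauss map, in the direction `X`. -/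
noncomputable def _root_.HyperbolicQuadric.cubicMatrix
    (A B : EuclideanSpace ℝ (Fin n) → Fin (n + 2) → ℝ) (x X : EuclideanSpace ℝ (Fin n)) :
    Matrix (Fin n) (Fin n) ℝ :=
  Matrix.of fun i j => cubicForm A B x X (stdVec i) (stdVec j)

lemma gram_gaussCoord_posDef (h0 : nullCoord ε (cplx (A x) (B x)) ≠ 0) :
    (gram (coordMetric ε (gaussCoord ε A B x))
      (diffAt (gaussCoord ε A B) x)).PosDef := by
  refine gram_posDef (fun X Y => coordMetric_comm ε (h.herm_coneSection_gaussCoord h0) _ _)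
    fun X hX => ?_
  have := h.coordMetric_gaussCoord_pos h0 h.isFrame.normal_nonneg X 0 (Or.inl hX)
  simpa using this

lemma hasDerivAt_angleDet (h0 : nullCoord ε (cplx (A x) (B x)) ≠ 0)
    (X : EuclideanSpace ℝ (Fin n)) :
    angleDet A B 1 x ≠ 0 ∧
    (fderiv ℝ (angleDet A B 1) x X / angleDet A B 1 x).im =
      -((gram (coordMetric ε (gaussCoord ε A B x))
        (diffAt (gaussCoord ε A B) x))⁻¹ * cubicMatrix A B x X).trace := by
  have hf := h.isFrame
  set T := diffAt A x with hT
  set D := diffAt B x with hD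
  set G := gram (realForm n) T with hG
  set S := shapeMatrix T D with hS
  set Γ := gram (coordMetric ε (gaussCoord ε A B x))
      (diffAt (gaussCoord ε A B) x) with hΓ
  set P : Matrix (Fin n) (Fin n) ℝ :=
    Matrix.of fun i j => realForm n (fderiv ℝ (fderiv ℝ A) x X (stdVec i)) (T (stdVec j)) with hP
  have hGt : Gᵀ = G := by ext i j; exact realForm_comm _ _
  have h2Γ : (2 : ℝ) • Γ = G + Sᵀ * G * S := by
    rw [hΓ, h.gram_gaussCoord h0, ← hf.gram_normal]
  have hΓ0 : Γ.det ≠ 0 := (h.gram_gaussCoord_posDef h0).det_pos.ne'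
  obtain ⟨hne, him⟩ := im_trace_inv_mul (P := P) (C := cubicMatrix A B x X) hGt
    hf.gram_mul_shapeMatrix_transpose h2Γ hΓ0
  have hGd := h.det_toC_gram_ne_zero
  have hline := fun Y => hasDerivAt_fderiv_line h.smooth X Y
  have hline' := fun Y => hasDerivAt_fderiv_line h.smooth_normal X Y
  have hPS : ∀ i j, (P * S) i j = -realForm n (fderiv ℝ (fderiv ℝ A) x X (stdVec i))
      (D (stdVec j)) := by
    intro i j
    rw [hf.apply_stdVec, map_neg, neg_neg, map_sum, mul_apply]
    refine Finset.sum_congr rfl fun l _ => ?_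
    rw [map_smul, smul_eq_mul, mul_comm]
    rfl
  have d1 : ∀ i j, HasDerivAt (fun s : ℝ => gram (realForm n)
      (diffAt A (x + s • X)) i j) ((P + Pᵀ) i j) 0 := by
    intro i j
    refine (hasDerivAt_realForm (hline (stdVec i)) (hline (stdVec j))).congr_deriv ?_
    rw [zero_smul, add_zero, Matrix.add_apply, transpose_apply, realForm_comm (fderiv ℝ A x _)]
    rfl
  -- The term with the second derivative of `B` is traded, through the definition and symmetry of
  -- the cubic form, for one with the second derivative of `A` and twice the cubic form.
  have d2 : ∀ i j, HasDerivAt (fun s : ℝ => secondMatrix (diffAt A (x + s • X))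
      (diffAt B (x + s • X)) i j)
      ((P * S + (P * S)ᵀ - (2 : ℝ) • cubicMatrix A B x X) i j) 0 := by
    intro i j
    refine (hasDerivAt_realForm (hline (stdVec i)) (hline' (stdVec j))).neg.congr_deriv ?_
    rw [Matrix.sub_apply, Matrix.add_apply, transpose_apply, hPS, hPS, Matrix.smul_apply, cubicMatrix, of_apply,
      h.cubicForm_comm_right, cubicForm, zero_smul, add_zero, realForm_comm (fderiv ℝ A x _)]
    simp only [hD, ContinuousLinearMap.coe_coe, smul_eq_mul]
    ring
  have e1 := hasDerivAt_det_of_ne_zero (K := fun s : ℝ =>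
    toC (gram (realForm n) (diffAt A (x + s • X))) + (Complex.I * (1 : ℝ)) •
    toC (secondMatrix (diffAt A (x + s • X))
      (diffAt B (x + s • X)))) (t := 0)
    (K' := toC (P + Pᵀ) + (Complex.I * (1 : ℝ)) •
      toC (P * S + (P * S)ᵀ - (2 : ℝ) • cubicMatrix A B x X))
    (fun i j => (d1 i j).ofReal_comp.add ((d2 i j).ofReal_comp.const_mul _)) (by
      simp only [zero_smul, add_zero, Complex.ofReal_one, mul_one, ← hT, ← hD,
        ← hf.gram_mul_shapeMatrix]
      exact hne)
  have e2 := hasDerivAt_det_of_ne_zero (K := fun s : ℝ =>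
    toC (gram (realForm n) (diffAt A (x + s • X)))) (t := 0)
    (K' := toC (P + Pᵀ)) (fun i j => (d1 i j).ofReal_comp) (by simpa using hGd)
  have e3 := e1.div e2 (by simpa using hGd)
  have e4 := hasDerivAt_comp_line
    ((h.contDiffAt_angleDet 1).differentiableAt (by simp)) X
  have e5 := e4.unique e3
  have hA : angleDet A B 1 x = (toC G + Complex.I • toC (G * S)).det / (toC G).det := by
    rw [angleDet, Complex.ofReal_one, mul_one, ← hT, ← hD, ← hf.gram_mul_shapeMatrix]
  have hA0 : angleDet A B 1 x ≠ 0 := by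
    rw [hA]
    exact div_ne_zero hne hGd
  refine ⟨hA0, ?_⟩
  rw [← him, e5, hA]
  simp only [zero_smul, add_zero, Complex.ofReal_one, mul_one, ← hT, ← hD,
        ← hf.gram_mul_shapeMatrix, ← hG, ← hS]
  -- The denominator `det G` is real, so its logarithmic derivative does not affect the imaginary
  -- part.
  have hreal : ((toC G)⁻¹ * toC (P + Pᵀ)).trace =
      ((G⁻¹ * (P + Pᵀ)).trace : ℝ) := by
    have hGu : IsUnit G.det := isUnit_iff_ne_zero.2 hf.posDef.det_pos.ne'
    have : (toC G)⁻¹ = toC G⁻¹ := inv_eq_right_inv (by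
      rw [← toC_mul, mul_nonsing_inv _ hGu, toC_one])
    rw [this, ← trace_toC, toC_mul]
  have hfin : ∀ a b c d : ℂ, a ≠ 0 → b ≠ 0 →
      (a * c * b - a * (b * d)) / b ^ 2 / (a / b) = c - d := by
    intro a b c d ha hb
    field_simp
  rw [hfin _ _ _ _ hne hGd, hreal, Complex.sub_im, Complex.ofReal_im, sub_zero]

/-- The one-form `g (J H, ·)` of the Gauss map in coordinates. -/
lemma coordMetric_meanCurvature (h0 : nullCoord ε (cplx (A x) (B x)) ≠ 0)
    (X : EuclideanSpace ℝ (Fin n)) (τ : Fin n → Fin n → EuclideanSpace ℝ (Fin n)) (r : ℝ) :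
    coordMetric ε (gaussCoord ε A B x) (Complex.I • (r • ∑ i, ∑ j,
      (gram (coordMetric ε (gaussCoord ε A B x))
        (diffAt (gaussCoord ε A B) x))⁻¹ i j •
        (fderiv ℝ (fderiv ℝ (gaussCoord ε A B)) x (stdVec i) (stdVec j) +
          christoffel ε (gaussCoord ε A B x) (fderiv ℝ (gaussCoord ε A B) x (stdVec i))
            (fderiv ℝ (gaussCoord ε A B) x (stdVec j)) -
          fderiv ℝ (gaussCoord ε A B) x (τ i j)) : Fin n → ℂ))
      (fderiv ℝ (gaussCoord ε A B) x X) =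
    r * (fderiv ℝ (angleDet A B 1) x X / angleDet A B 1 x).im := by
  have hn := h.herm_coneSection_gaussCoord h0
  -- The tangent space of the Lagrangian and its image under `i` have total real dimension `2 n`, so
  -- positivity on sums of their vectors is positivity on all of `ℂ^n`.
  have hpos : ∀ ξ, ξ ≠ 0 → 0 < coordMetric ε (gaussCoord ε A B x) ξ ξ := by
    let L : EuclideanSpace ℝ (Fin n) × EuclideanSpace ℝ (Fin n) →ₗ[ℝ] (Fin n → ℂ) :=
      LinearMap.coprod (diffAt (gaussCoord ε A B) x)
        (LinearMap.comp (LinearMap.lsmul ℂ (Fin n → ℂ) Complex.I |>.restrictScalars ℝ)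
          (diffAt (gaussCoord ε A B) x))
    have hL : ∀ Y Z, L (Y, Z) = fderiv ℝ (gaussCoord ε A B) x Y +
      Complex.I • fderiv ℝ (gaussCoord ε A B) x Z := fun Y Z => rfl
    have hLpos : ∀ Y Z, Y ≠ 0 ∨ Z ≠ 0 →
        0 < coordMetric ε (gaussCoord ε A B x) (L (Y, Z)) (L (Y, Z)) := fun Y Z hYZ => by
      rw [hL]
      exact h.coordMetric_gaussCoord_pos h0 h.isFrame.normal_nonneg Y Z hYZ
    have hinj : Function.Injective L := by
      rw [injective_iff_map_eq_zero]
      rintro ⟨Y, Z⟩ hYZ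
      by_contra hne
      have h1 := hLpos Y Z (by
        by_contra hc
        push Not at hc
        exact hne (by rw [hc.1, hc.2]; rfl))
      rw [hYZ, map_zero] at h1
      exact lt_irrefl _ h1
    have hdim : Module.finrank ℝ (EuclideanSpace ℝ (Fin n) × EuclideanSpace ℝ (Fin n)) =
        Module.finrank ℝ (Fin n → ℂ) := by
      rw [Module.finrank_prod, finrank_euclideanSpace_fin, Module.finrank_pi_fintype]
      simp [Complex.finrank_real_complex]
      ring
    intro ξ hξ
    obtain ⟨⟨Y, Z⟩, rfl⟩ :=
      (LinearMap.injective_iff_surjective_of_finrank_eq_finrank hdim).1 hinj ξ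
    refine hLpos Y Z ?_
    by_contra hc
    push Not at hc
    rw [hc.1, hc.2] at hξ
    exact hξ (map_zero L)
  rw [(h.hasDerivAt_angleDet h0 X).2, coordMetric_I_left ε hn]
  -- The vectors `dG (τ i j)` are tangent, hence orthogonal to `i dG X`: the normal projection plays
  -- no role, whatever `τ` is.
  simp only [map_smul, map_sum, LinearMap.smul_apply, LinearMap.sum_apply, smul_eq_mul, map_sub,
    LinearMap.sub_apply, h.coordMetric_covariantHessian h0 hpos,
    (h.coordMetric_gaussCoord h0 _ _).2, sub_zero, trace, diag_apply, mul_apply]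
  rw [mul_neg]
  refine congrArg (fun s => -(r * s)) ?_
  refine Finset.sum_congr rfl fun i _ => Finset.sum_congr rfl fun j _ => ?_
  rw [cubicMatrix, of_apply, h.cubicForm_comm_left X, h.cubicForm_comm_right (stdVec j) X,
    h.cubicForm_comm_left (stdVec j)]

end IsLocalFront

end Angle

/-! ### Continuous branches of the argument of a product -/

section Arg

/-- The number `arctan t` is an argument of `1 + i t`, as its cosine and sine show. -/
lemma exp_sum_arctan {ι : Type*} [Fintype ι] (lam : ι → ℝ) :
    Complex.exp (Complex.I * (∑ j, Real.arctan (lam j) : ℝ)) =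
      (∏ j, (1 + Complex.I * lam j)) / ‖∏ j, (1 + Complex.I * lam j)‖ := by
  have h : ∀ t : ℝ, Complex.exp (Complex.I * (Real.arctan t : ℝ)) =
      (1 + Complex.I * t) / ‖1 + Complex.I * t‖ := by
    intro t
    have hn : ‖1 + Complex.I * t‖ = √(1 + t ^ 2) := by
      rw [Complex.norm_def, Complex.normSq_apply]
      simp
      congr 1; ring
    rw [hn, mul_comm, Complex.exp_mul_I, ← Complex.ofReal_cos, ← Complex.ofReal_sin,
      Real.cos_arctan, Real.sin_arctan]
    push_cast
    ring
  rw [Complex.ofReal_sum, Finset.mul_sum, Complex.exp_sum, Finset.prod_congr rfl fun j _ => h _,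
    Finset.prod_div_distrib, norm_prod]
  push_cast
  rfl

lemma one_add_I_mul_ne_zero (t : ℝ) : (1 + Complex.I * t : ℂ) ≠ 0 := by
  intro h
  have := congrArg Complex.re h
  simp at this

lemma exp_I_mul_arg {z : ℂ} (hz : z ≠ 0) : Complex.exp (Complex.I * (z.arg : ℝ)) = z / ‖z‖ := by
  have h1 : (‖z‖ : ℂ) ≠ 0 := by exact_mod_cast norm_ne_zero_iff.2 hz
  rw [eq_div_iff h1, mul_comm, mul_comm Complex.I]
  exact Complex.norm_mul_exp_arg_mul_I z

/-- A continuous function on `[0, 1]` with values in `2 π ℤ` is constant. -/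
lemma eq_of_exp_I_mul_eq_one {g : ℝ → ℝ} (hg : ContinuousOn g (Set.Icc 0 1))
    (h1 : ∀ t ∈ Set.Icc (0 : ℝ) 1, Complex.exp (Complex.I * g t) = 1) : g 1 = g 0 := by
  have hm : ∀ t ∈ Set.Icc (0 : ℝ) 1, g t / (2 * Real.pi) ∈ Set.range ((↑) : ℤ → ℝ) := by
    intro t ht
    obtain ⟨k, hk⟩ := Complex.exp_eq_one_iff.1 (h1 t ht)
    refine ⟨k, ?_⟩
    have h2 : (g t : ℂ) = k * (2 * Real.pi) := by
      refine mul_left_cancel₀ Complex.I_ne_zero ?_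
      rw [hk]; ring
    have h3 : g t = k * (2 * Real.pi) := by exact_mod_cast h2
    rw [h3]
    field_simp
  have hd : IsDiscrete (Set.range ((↑) : ℤ → ℝ)) :=
    ⟨(Int.isClosedEmbedding_coe_real.isEmbedding.toHomeomorph).symm.isEmbedding.discreteTopology⟩
  have := (isPreconnected_Icc (a := (0 : ℝ)) (b := 1)).constant_of_mapsTo
    (T := Set.range ((↑) : ℤ → ℝ)) hd (hg.div_const _) hm
    (Set.right_mem_Icc.2 zero_le_one) (Set.left_mem_Icc.2 zero_le_one)
  exact (div_left_inj' (by positivity)).1 this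

variable {ι M : Type*} [Fintype ι] [TopologicalSpace M]

/-- The sum of the arctangents is locally the argument of the product, up to a constant. -/
lemma sum_arctan_eventually_eq {lam : ι → M → ℝ} {Φ : ℝ → M → ℂ} {p : M}
    (hΦ : ∀ᶠ q in nhds p, ∀ t, Φ t q = ∏ j, (1 + Complex.I * t * lam j q))
    (hc : ∀ t ∈ Set.Icc (0 : ℝ) 1, ContinuousAt (fun z : M × ℝ => Φ z.2 z.1) (p, t)) :
    ∀ᶠ q in nhds p, ∑ j, Real.arctan (lam j q) =
      ∑ j, Real.arctan (lam j p) + (Φ 1 q / Φ 1 p).arg := by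
  have hp := hΦ.self_of_nhds
  have hcast : ∀ (q : M) (t : ℝ), ∏ j, (1 + Complex.I * t * lam j q) =
      ∏ j, (1 + Complex.I * ((t * lam j q : ℝ) : ℂ)) := by
    intro q t
    push_cast
    simp only [mul_assoc]
  have hne : ∀ (q : M) (t : ℝ), ∏ j, (1 + Complex.I * t * lam j q) ≠ 0 := by
    intro q t
    rw [hcast]
    exact Finset.prod_ne_zero_iff.2 fun j _ => one_add_I_mul_ne_zero _
  have hpc : Continuous fun t => Φ t p := by
    simp only [hp]
    fun_prop
  have hp0 : ∀ t, Φ t p ≠ 0 := fun t => by rw [hp]; exact hne p t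
  -- At `q = p` the quotient is `1`; compactness of `[0, 1]` gives one neighbourhood of `p` on which
  -- it avoids the cut for all `t` at once.
  have hslit : ∀ᶠ q in nhds p, ∀ t ∈ Set.Icc (0 : ℝ) 1,
      Φ t q / Φ t p ∈ Complex.slitPlane := by
    refine isCompact_Icc.eventually_forall_of_forall_eventually fun t ht => ?_
    have h1 : ContinuousAt (fun z : M × ℝ => Φ z.2 z.1 / Φ z.2 p) (p, t) :=
      (hc t ht).div (ContinuousAt.comp (f := Prod.snd) hpc.continuousAt continuousAt_snd) (hp0 t)
    refine h1.eventually (Complex.isOpen_slitPlane.mem_nhds ?_)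
    change Φ t p / Φ t p ∈ _
    rw [div_self (hp0 t)]
    exact Complex.one_mem_slitPlane
  filter_upwards [hslit, hΦ] with q hq hΦq
  have hqc : Continuous fun t => Φ t q := by
    simp only [hΦq]
    fun_prop
  -- For fixed `q` the discrepancy between the two arguments is continuous in `t`, takes values in
  -- `2 π ℤ` and vanishes at `t = 0`. The eigenvalues are frozen at `p` and `q`, so `lam` need not
  -- be continuous.
  have hg : ContinuousOn (fun t : ℝ => ∑ j, Real.arctan (t * lam j q) -
      ∑ j, Real.arctan (t * lam j p) - (Φ t q / Φ t p).arg) (Set.Icc 0 1) := by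
    have ha : Continuous fun t : ℝ => ∑ j, Real.arctan (t * lam j q) :=
      continuous_finsetSum _ fun j _ => Real.continuous_arctan.comp (by fun_prop)
    have hb : Continuous fun t : ℝ => ∑ j, Real.arctan (t * lam j p) :=
      continuous_finsetSum _ fun j _ => Real.continuous_arctan.comp (by fun_prop)
    refine (ha.sub hb).continuousOn.sub fun t ht => ?_
    have hr : Continuous fun t => Φ t q / Φ t p := hqc.div hpc hp0
    exact (ContinuousAt.comp (f := fun t => Φ t q / Φ t p) (Complex.continuousAt_arg (hq t ht))
      hr.continuousAt).continuousWithinAt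
  have h1 := eq_of_exp_I_mul_eq_one hg (by
    intro t _
    have hq0 : Φ t q ≠ 0 := by rw [hΦq]; exact hne q t
    have n1 : (‖Φ t q‖ : ℂ) ≠ 0 := by exact_mod_cast norm_ne_zero_iff.2 hq0
    have n2 : (‖Φ t p‖ : ℂ) ≠ 0 := by exact_mod_cast norm_ne_zero_iff.2 (hp0 t)
    have n3 := hp0 t
    have e1 := exp_sum_arctan fun j => t * lam j q
    have e2 := exp_sum_arctan fun j => t * lam j p
    rw [← hcast, ← hΦq] at e1
    rw [← hcast, ← hp] at e2
    rw [Complex.ofReal_sub, Complex.ofReal_sub, mul_sub, mul_sub, Complex.exp_sub, Complex.exp_sub,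
      e1, e2, exp_I_mul_arg (div_ne_zero hq0 n3), norm_div, Complex.ofReal_div]
    field_simp)
  have h0 : ∀ q, (∀ t, Φ t q = ∏ j, (1 + Complex.I * t * lam j q)) → Φ 0 q = 1 := by
    intro q h
    rw [h]
    simp
  simp only [one_mul, zero_mul, h0 q hΦq, h0 p hp, div_one, Complex.arg_one, Real.arctan_zero,
    sub_self] at h1
  linarith

/-- Continuous branches of the logarithm differ locally by a constant from the principal one. -/
lemma log_branch_eventually_eq {ell Ψ : M → ℂ} {p : M} (hell : ContinuousAt ell p)
    (hexp : ∀ᶠ q in nhds p, Complex.exp (ell q) = Ψ q) (hΨ : ContinuousAt Ψ p) :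
    ∀ᶠ q in nhds p, ell q = ell p + Complex.log (Ψ q / Ψ p) := by
  have hp := hexp.self_of_nhds
  have h0 : Ψ p ≠ 0 := by rw [← hp]; exact Complex.exp_ne_zero _
  have hr : ContinuousAt (fun q => Ψ q / Ψ p) p := hΨ.div_const _
  have h1 : Ψ p / Ψ p = 1 := div_self h0
  have hlog : ContinuousAt (fun q => Complex.log (Ψ q / Ψ p)) p :=
    hr.clog (by rw [h1]; exact Complex.one_mem_slitPlane)
  have hd : ContinuousAt (fun q => ell q - (ell p + Complex.log (Ψ q / Ψ p))) p :=
    hell.sub (continuousAt_const.add hlog)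
  have hd0 : ell p - (ell p + Complex.log (Ψ p / Ψ p)) = 0 := by
    rw [h1, Complex.log_one]; ring
  -- Two logarithms of the same number differ by a multiple of `2 π i`; a difference of modulus less
  -- than `2 π` is zero.
  have hsmall : ∀ᶠ q in nhds p, ‖ell q - (ell p + Complex.log (Ψ q / Ψ p))‖ < 2 * Real.pi := by
    refine hd.norm.eventually (gt_mem_nhds ?_)
    change ‖ell p - (ell p + Complex.log (Ψ p / Ψ p))‖ < _
    rw [hd0, norm_zero]
    positivity
  filter_upwards [hsmall, hexp] with q hq hq'
  have hq0 : Ψ q ≠ 0 := by rw [← hq']; exact Complex.exp_ne_zero _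
  have he : Complex.exp (ell q - (ell p + Complex.log (Ψ q / Ψ p))) = 1 := by
    rw [Complex.exp_sub, Complex.exp_add, Complex.exp_log (div_ne_zero hq0 h0), hp, hq']
    field_simp
  obtain ⟨k, hk⟩ := Complex.exp_eq_one_iff.1 he
  have hk0 : k = 0 := by
    rw [hk] at hq
    simp only [norm_mul, Complex.norm_intCast, Complex.norm_ofNat, Complex.norm_real,
      Complex.norm_I, mul_one, Real.norm_eq_abs, abs_of_pos Real.pi_pos] at hq
    have : |(k : ℝ)| < 1 := by
      by_contra hc
      push Not at hc
      nlinarith [Real.pi_pos]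
    rw [← Int.cast_abs] at this
    have h2 : |k| < 1 := by exact_mod_cast this
    exact Int.abs_lt_one_iff.1 h2
  rw [hk0, Int.cast_zero, zero_mul] at hk
  exact sub_eq_zero.1 hk

end Arg

/-! ### Passage to the manifold -/

section Conjugation

variable {n : ℕ} {a b : Fin (n + 2) → ℝ}
  {T D : EuclideanSpace ℝ (Fin n) →ₗ[ℝ] (Fin (n + 2) → ℝ)}

lemma IsFrame.comp_equiv (h : IsFrame a b T D)
    (e : EuclideanSpace ℝ (Fin n) ≃ₗ[ℝ] EuclideanSpace ℝ (Fin n)) :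
    IsFrame a b (T ∘ₗ e.toLinearMap) (D ∘ₗ e.toLinearMap) :=
  ⟨h.mem, h.unit, h.tangent, fun _ => h.left _, fun _ => h.right _, fun _ => h.left_normal _,
    fun _ => h.right_normal _, fun _ _ => h.comm _ _,
    fun X hX => h.pos _ (by simpa using hX)⟩

/-- The shape operator is determined by `T S = -D` because `T` is injective, so a change of
coordinates `e` conjugates it. -/
lemma IsFrame.charpoly_comp_equiv (h : IsFrame a b T D)
    (e : EuclideanSpace ℝ (Fin n) ≃ₗ[ℝ] EuclideanSpace ℝ (Fin n)) :
    (shapeOf (T ∘ₗ e.toLinearMap) (D ∘ₗ e.toLinearMap)).charpoly = (shapeOf T D).charpoly := by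
  have h' := h.comp_equiv e
  rw [← LinearEquiv.charpoly_conj e]
  congr 1
  ext1 X
  refine h.injective ?_
  have := h'.apply_shapeOf (e.symm X)
  rw [h.apply_shapeOf]
  simpa [LinearEquiv.conj_apply] using this

end Conjugation

/-! ### Local expressions in the preferred charts -/

section Manifold

variable {n : ℕ} {M : Type*} [TopologicalSpace M] [ChartedSpace (EuclideanSpace ℝ (Fin n)) M]

/-- A function in the preferred coordinates at `p`. -/
noncomputable def inChart {F : Type*} (f : M → F) (p : M) : EuclideanSpace ℝ (Fin n) → F :=
  f ∘ (extChartAt (𝓡 n) p).symm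

lemma inChart_extChartAt {F : Type*} (f : M → F) (p : M) {q : M}
    (hq : q ∈ (extChartAt (𝓡 n) p).source) : inChart f p (extChartAt (𝓡 n) p q) = f q := by
  rw [inChart, Function.comp_apply, (extChartAt (𝓡 n) p).left_inv hq]

variable [IsManifold (𝓡 n) ∞ M]

lemma contDiffAt_inChart {F : Type*} [NormedAddCommGroup F] [NormedSpace ℝ F] {f : M → F}
    (hf : ContMDiff (𝓡 n) 𝓘(ℝ, F) ∞ f) (p : M) {y : EuclideanSpace ℝ (Fin n)}
    (hy : y ∈ (extChartAt (𝓡 n) p).target) : ContDiffAt ℝ ∞ (inChart f p) y := by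
  have h1 : ContMDiffAt 𝓘(ℝ, EuclideanSpace ℝ (Fin n)) (𝓡 n) ∞ (extChartAt (𝓡 n) p).symm y :=
    (contMDiffOn_extChartAt_symm p).contMDiffAt ((isOpen_extChartAt_target p).mem_nhds hy)
  exact (hf.contMDiffAt.comp y h1).contDiffAt

/-- The differential in the preferred coordinates at another point. -/
lemma exists_dReal_eq (p : M) {q : M} (hq : q ∈ (extChartAt (𝓡 n) p).source) :
    ∃ e : EuclideanSpace ℝ (Fin n) ≃ₗ[ℝ] EuclideanSpace ℝ (Fin n),
      ∀ f : M → Fin (n + 2) → ℝ, ContMDiff (𝓡 n) 𝓘(ℝ, Fin (n + 2) → ℝ) ∞ f →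
        dReal f q = diffAt (inChart f p) (extChartAt (𝓡 n) p q) ∘ₗ e.toLinearMap := by
  have : IsManifold (𝓡 n) 1 M := IsManifold.of_le (n := ∞) (by norm_cast)
  obtain ⟨e, he⟩ := isInvertible_mfderiv_extChartAt hq
  refine ⟨e.toLinearEquiv, fun f hf => ?_⟩
  have hy := (extChartAt (𝓡 n) p).map_source hq
  have h1 : f =ᶠ[nhds q] inChart f p ∘ extChartAt (𝓡 n) p := by
    filter_upwards [(isOpen_extChartAt_source p).mem_nhds hq] with q' hq'
    exact (inChart_extChartAt f p hq').symm
  have h2 : MDifferentiableAt (𝓡 n) 𝓘(ℝ, EuclideanSpace ℝ (Fin n)) (extChartAt (𝓡 n) p) q :=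
    mdifferentiableAt_extChartAt (by simpa using hq)
  have h3 : MDifferentiableAt 𝓘(ℝ, EuclideanSpace ℝ (Fin n)) 𝓘(ℝ, Fin (n + 2) → ℝ)
      (inChart f p) (extChartAt (𝓡 n) p q) :=
    ((contDiffAt_inChart hf p hy).differentiableAt (by simp)).mdifferentiableAt
  have h4 : mfderiv (𝓡 n) 𝓘(ℝ, Fin (n + 2) → ℝ) f q =
      (fderiv ℝ (inChart f p) (extChartAt (𝓡 n) p q)).comp
        (mfderiv (𝓡 n) 𝓘(ℝ, EuclideanSpace ℝ (Fin n)) (extChartAt (𝓡 n) p) q) := by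
    rw [h1.mfderiv_eq, mfderiv_comp q h3 h2, mfderiv_eq_fderiv]
    rfl
  rw [dReal, h4, ← he]
  rfl

omit [IsManifold (𝓡 n) ∞ M] in
lemma mfderiv_eq_fderiv_inChart {F : Type*} [NormedAddCommGroup F] [NormedSpace ℝ F] {f : M → F}
    {p : M} (hf : MDifferentiableAt (𝓡 n) 𝓘(ℝ, F) f p) :
    mfderiv (𝓡 n) 𝓘(ℝ, F) f p = fderiv ℝ (inChart f p) (extChartAt (𝓡 n) p p) := by
  refine hf.mfderiv.trans ?_
  simp only [ModelWithCorners.range_eq_univ, fderivWithin_univ]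
  rfl

variable {a b : M → Fin (n + 2) → ℝ} (h : IsSpacelikeWithNormal a b)
include h

/-- The hypotheses at `q` refer to the preferred chart at `q`, the conclusion to the fixed chart at
`p`; the invertible change of tangent vectors carries one to the other. -/
lemma IsSpacelikeWithNormal.isLocalFront (p : M) :
    IsLocalFront (inChart a p) (inChart b p) (extChartAt (𝓡 n) p p) := by
  have ht := extChartAt_target_mem_nhds (I := 𝓡 n) p
  have key : ∀ y ∈ (extChartAt (𝓡 n) p).target, ∃ e : EuclideanSpace ℝ (Fin n) ≃ₗ[ℝ] _,
      ∀ X, fderiv ℝ (inChart a p) y X = dReal a ((extChartAt (𝓡 n) p).symm y) (e.symm X) := by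
    intro y hy
    obtain ⟨e, he⟩ := exists_dReal_eq p ((extChartAt (𝓡 n) p).map_target hy)
    refine ⟨e, fun X => ?_⟩
    rw [he a h.contMDiff, (extChartAt (𝓡 n) p).right_inv hy]
    simp
  refine ⟨contDiffAt_inChart h.contMDiff p (mem_extChartAt_target p),
    contDiffAt_inChart h.contMDiff_normal p (mem_extChartAt_target p),
    Filter.Eventually.of_forall fun y => h.mem _, Filter.Eventually.of_forall fun y => h.unit _,
    Filter.Eventually.of_forall fun y => h.tangent _, ?_, ?_⟩
  · filter_upwards [ht] with y hy X
    obtain ⟨e, he⟩ := key y hy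
    rw [he]
    exact h.normal _ _
  · filter_upwards [ht] with y hy X hX
    obtain ⟨e, he⟩ := key y hy
    rw [he]
    exact h.spacelike _ _ (by simpa using hX)

lemma IsSpacelikeWithNormal.eventually_charpoly (p : M) : ∀ᶠ q in nhds p,
    IsFrame (a q) (b q) (diffAt (inChart a p) (extChartAt (𝓡 n) p q))
      (diffAt (inChart b p) (extChartAt (𝓡 n) p q)) ∧
    (shapeOperator a b q).charpoly = (shapeOf (diffAt (inChart a p) (extChartAt (𝓡 n) p q))
      (diffAt (inChart b p) (extChartAt (𝓡 n) p q))).charpoly := by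
  filter_upwards [(continuousAt_extChartAt (I := 𝓡 n) p).eventually
    (h.isLocalFront p).eventually_isFrame, extChartAt_source_mem_nhds (I := 𝓡 n) p] with q hq hqs
  rw [inChart_extChartAt a p hqs, inChart_extChartAt b p hqs] at hq
  refine ⟨hq, ?_⟩
  obtain ⟨e, he⟩ := exists_dReal_eq p hqs
  rw [← hq.charpoly_comp_equiv e, ← he a h.contMDiff, ← he b h.contMDiff_normal]
  rfl

lemma IsSpacelikeWithNormal.exists_principalCurvatures :
    ∃ lam : Fin n → M → ℝ, IsPrincipalCurvatures a b lam := by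
  have key : ∀ p, ∃ lam : Fin n → ℝ,
      (shapeOperator a b p).charpoly = ∏ j, (Polynomial.X - Polynomial.C (lam j)) := by
    intro p
    obtain ⟨h1, h2⟩ := (h.eventually_charpoly p).self_of_nhds
    rw [h2]
    exact h1.exists_charpoly_shapeOf
  choose lam hlam using key
  exact ⟨fun j p => lam p j, hlam⟩

lemma IsSpacelikeWithNormal.eventually_angleDet {lam : Fin n → M → ℝ}
    (hl : IsPrincipalCurvatures a b lam) (p : M) : ∀ᶠ q in nhds p, ∀ t : ℝ,
      angleDet (inChart a p) (inChart b p) t (extChartAt (𝓡 n) p q) =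
        ∏ j, (1 + Complex.I * t * lam j q) := by
  filter_upwards [h.eventually_charpoly p] with q hq t
  rw [angleDet, det_toC]
  exact hq.1.det_gram_add (hq.2.symm.trans (hl q)) _

/-! ### The Gauss map in coordinates -/

omit [IsManifold (𝓡 n) ∞ M] in
-- The chart is homogeneous of degree zero, so the unknown factor between the chosen representative
-- and `a + i b` cancels.
lemma IsSpacelikeWithNormal.chart_gaussMap (ε : ℤˣ) (q : M) :
    chart n ε (gaussMap h q) =
      fun j => cplx (a q) (b q) j.succ.succ / nullCoord ε (cplx (a q) (b q)) := by
  obtain ⟨c, hc, hr⟩ : ∃ c : ℂ, c ≠ 0 ∧ (gaussMap h q).rep = c • cplx (a q) (b q) :=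
    QStar.exists_rep_mk _ _ _
  funext j
  change (gaussMap h q).rep _ / nullCoord ε (gaussMap h q).rep = _
  rw [hr, nullCoord_smul, Pi.smul_apply, smul_eq_mul, mul_div_mul_left _ _ hc]

omit [IsManifold (𝓡 n) ∞ M] in
lemma IsSpacelikeWithNormal.mem_chart_source (ε : ℤˣ) (q : M) :
    gaussMap h q ∈ (chart n ε).source ↔
      ‖nullCoord (-ε) (cplx (a q) (b q))‖ < ‖nullCoord ε (cplx (a q) (b q))‖ := by
  obtain ⟨c, hc, hr⟩ : ∃ c : ℂ, c ≠ 0 ∧ (gaussMap h q).rep = c • cplx (a q) (b q) :=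
    QStar.exists_rep_mk _ _ _
  change ‖nullCoord (-ε) (gaussMap h q).rep‖ < ‖nullCoord ε (gaussMap h q).rep‖ ↔ _
  rw [hr, nullCoord_smul, nullCoord_smul, norm_mul, norm_mul,
    mul_lt_mul_iff_right₀ (norm_pos_iff.2 hc)]

omit [IsManifold (𝓡 n) ∞ M] in
lemma IsSpacelikeWithNormal.writtenInExtChartAt_gaussMap (p : M) :
    writtenInExtChartAt (𝓡 n) 𝓘(ℝ, Fin n → ℂ) p (gaussMap h) =
      gaussCoord (side (gaussMap h p)) (inChart a p) (inChart b p) := by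
  funext y
  exact h.chart_gaussMap _ _

omit [IsManifold (𝓡 n) ∞ M] in
lemma IsSpacelikeWithNormal.coord_gaussMap (p : M) : coord (gaussMap h p) =
    gaussCoord (side (gaussMap h p)) (inChart a p) (inChart b p) (extChartAt (𝓡 n) p p) := by
  rw [coord, h.chart_gaussMap]
  funext j
  rw [gaussCoord, inChart_extChartAt a p (mem_extChartAt_source p),
    inChart_extChartAt b p (mem_extChartAt_source p)]

omit [IsManifold (𝓡 n) ∞ M] in
lemma IsSpacelikeWithNormal.nullCoord_ne_zero (p : M) :
    nullCoord (side (gaussMap h p)) (cplx (inChart a p (extChartAt (𝓡 n) p p))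
      (inChart b p (extChartAt (𝓡 n) p p))) ≠ 0 := by
  rw [inChart_extChartAt a p (mem_extChartAt_source p),
    inChart_extChartAt b p (mem_extChartAt_source p)]
  exact norm_pos_iff.1 (lt_of_le_of_lt (norm_nonneg _)
    ((h.mem_chart_source _ p).1 (mem_chart_side _)))

lemma IsSpacelikeWithNormal.contMDiff_gaussMap :
    ContMDiff (𝓡 n) 𝓘(ℝ, Fin n → ℂ) ∞ (gaussMap h) := by
  intro p
  set ε := side (gaussMap h p) with hε
  -- The component of the quadric is singled out by an open condition, so one chart serves near `p`.
  have hev : ∀ᶠ q in nhds p, gaussMap h q ∈ (chart n ε).source := by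
    have ha : Continuous a := h.contMDiff.continuous
    have hb : Continuous b := h.contMDiff_normal.continuous
    have hn : ∀ δ : ℤˣ, Continuous fun q => ‖nullCoord δ (cplx (a q) (b q))‖ := by
      intro δ
      simp only [nullCoord, cplx]
      fun_prop
    filter_upwards [(isOpen_lt (hn (-ε)) (hn ε)).mem_nhds
      ((h.mem_chart_source ε p).1 (mem_chart_side _))] with q hq
    exact (h.mem_chart_source ε q).2 hq
  have heq : gaussMap h =ᶠ[nhds p] (extChartAt 𝓘(ℝ, Fin n → ℂ) (gaussMap h p)).symm ∘
      (gaussCoord ε (inChart a p) (inChart b p) ∘ extChartAt (𝓡 n) p) := by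
    filter_upwards [hev, extChartAt_source_mem_nhds (I := 𝓡 n) p] with q hq hqs
    have h1 : gaussCoord ε (inChart a p) (inChart b p) (extChartAt (𝓡 n) p q) =
        chart n ε (gaussMap h q) := by
      rw [h.chart_gaussMap]
      funext j
      rw [gaussCoord, inChart_extChartAt a p hqs, inChart_extChartAt b p hqs]
    rw [Function.comp_apply, Function.comp_apply, h1]
    exact ((chart n ε).left_inv hq).symm
  refine ContMDiffAt.congr_of_eventuallyEq ?_ heq
  have h1 : ContMDiffAt (𝓡 n) 𝓘(ℝ, Fin n → ℂ) ∞
      (gaussCoord ε (inChart a p) (inChart b p) ∘ extChartAt (𝓡 n) p) p :=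
    ((h.isLocalFront p).contDiffAt_gaussCoord (h.nullCoord_ne_zero p)).contMDiffAt.comp p
      contMDiffAt_extChartAt
  refine ContMDiffAt.comp p ?_ h1
  have h2 : (gaussCoord ε (inChart a p) (inChart b p) ∘ extChartAt (𝓡 n) p) p =
      extChartAt 𝓘(ℝ, Fin n → ℂ) (gaussMap h p) (gaussMap h p) :=
    (h.coord_gaussMap p).symm
  rw [h2]
  exact (contMDiffOn_extChartAt_symm _).contMDiffAt (extChartAt_target_mem_nhds _)

lemma IsSpacelikeWithNormal.mfderiv_gaussMap (p : M) :
    mfderiv (𝓡 n) 𝓘(ℝ, Fin n → ℂ) (gaussMap h) p =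
      fderiv ℝ (gaussCoord (side (gaussMap h p)) (inChart a p) (inChart b p))
        (extChartAt (𝓡 n) p p) := by
  refine (h.contMDiff_gaussMap.mdifferentiable (by simp) p).mfderiv.trans ?_
  simp only [ModelWithCorners.range_eq_univ, fderivWithin_univ, h.writtenInExtChartAt_gaussMap]
  rfl

lemma IsSpacelikeWithNormal.metric_gaussMap_pos (p : M) (X : TangentSpace (𝓡 n) p) (hX : X ≠ 0) :
    0 < metric (gaussMap h p) (mfderiv (𝓡 n) 𝓘(ℝ, Fin n → ℂ) (gaussMap h) p X)
      (mfderiv (𝓡 n) 𝓘(ℝ, Fin n → ℂ) (gaussMap h) p X) := by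
  have h1 := (h.isLocalFront p).coordMetric_gaussCoord_pos (h.nullCoord_ne_zero p)
    (h.isLocalFront p).isFrame.normal_nonneg X 0 (Or.inl hX)
  rw [map_zero, smul_zero, add_zero, ← h.coord_gaussMap p, ← h.mfderiv_gaussMap p] at h1
  exact h1

/-- In the preferred charts each ingredient is its coordinate counterpart, with the tangential parts
in the role of `τ`. For `n = 0` the factor `1 / n` is zero on both sides. -/
lemma IsSpacelikeWithNormal.maslovForm_gaussMap (p : M) (X : TangentSpace (𝓡 n) p) :
    maslovForm (gaussMap h) p X = 1 / n *
      (fderiv ℝ (angleDet (inChart a p) (inChart b p) 1) (extChartAt (𝓡 n) p p) X /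
        angleDet (inChart a p) (inChart b p) 1 (extChartAt (𝓡 n) p p)).im := by
  rw [← (h.isLocalFront p).coordMetric_meanCurvature (h.nullCoord_ne_zero p) X
    (fun i j => tangentialPart (metric (gaussMap h p)) (dQuad (gaussMap h) p)
      (covariantHessian (gaussMap h) p (stdVec i) (stdVec j)))]
  have hd : dQuad (gaussMap h) p = diffAt (gaussCoord (side (gaussMap h p)) (inChart a p)
      (inChart b p)) (extChartAt (𝓡 n) p p) := by
    rw [dQuad, h.mfderiv_gaussMap]
  rw [maslovForm, h.mfderiv_gaussMap]
  simp only [meanCurvature, secondFundamentalForm, hd]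
  simp only [metric, complexStructure, covariantHessian, hd, h.coord_gaussMap,
    h.writtenInExtChartAt_gaussMap]
  rfl

omit [IsManifold (𝓡 n) ∞ M] h in
-- Shared by the sum of arctangents and the branches of the logarithm. The quotient is `1` at `p`,
-- where the principal logarithm is smooth, and the differential there is the imaginary part of the
-- logarithmic derivative of `Ψ`.
lemma contMDiffAt_of_eventually_eq_log {Ψ : EuclideanSpace ℝ (Fin n) → ℂ} {p : M}
    (hΨ : ContDiffAt ℝ ∞ Ψ (extChartAt (𝓡 n) p p)) (h0 : Ψ (extChartAt (𝓡 n) p p) ≠ 0)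
    {f : M → ℝ} (c : ℝ) (hf : ∀ᶠ q in nhds p, f q =
      c + (Complex.log (Ψ (extChartAt (𝓡 n) p q) / Ψ (extChartAt (𝓡 n) p p))).im) :
    ContMDiffAt (𝓡 n) 𝓘(ℝ, ℝ) ∞ f p ∧ ∀ X : EuclideanSpace ℝ (Fin n), dFun f p X =
      (fderiv ℝ Ψ (extChartAt (𝓡 n) p p) X / Ψ (extChartAt (𝓡 n) p p)).im := by
  set x := extChartAt (𝓡 n) p p
  have h1 : Ψ x / Ψ x = 1 := div_self h0
  have hs : Ψ x / Ψ x ∈ Complex.slitPlane := by rw [h1]; exact Complex.one_mem_slitPlane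
  have hq : ContDiffAt ℝ ∞ (fun y => Ψ y / Ψ x) x := by
    simp only [div_eq_mul_inv]
    exact hΨ.mul contDiffAt_const
  have hL : ContDiffAt ℝ ∞ (fun y => c + (Complex.log (Ψ y / Ψ x)).im) x := by
    have hlog : ContDiffAt ℝ ∞ Complex.log (Ψ x / Ψ x) :=
      (Complex.contDiffAt_log hs).restrict_scalars ℝ
    have h2 : ContDiffAt ℝ ∞ (fun y => Complex.log (Ψ y / Ψ x)) x :=
      ContDiffAt.comp (f := fun y => Ψ y / Ψ x) x hlog hq
    exact contDiffAt_const.add (Complex.imCLM.contDiff.contDiffAt.comp x h2)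
  have hsm : ContMDiffAt (𝓡 n) 𝓘(ℝ, ℝ) ∞ f p :=
    (hL.contMDiffAt.comp p contMDiffAt_extChartAt).congr_of_eventuallyEq hf
  refine ⟨hsm, fun X => ?_⟩
  have hin : inChart f p =ᶠ[nhds x] fun y => c + (Complex.log (Ψ y / Ψ x)).im := by
    have hc : Filter.Tendsto (extChartAt (𝓡 n) p).symm (nhds x) (nhds p) := by
      have := continuousAt_extChartAt_symm (I := 𝓡 n) p
      rwa [ContinuousAt, extChartAt_to_inv] at this
    filter_upwards [hc.eventually hf, extChartAt_target_mem_nhds (I := 𝓡 n) p] with y hy hyt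
    rw [(extChartAt (𝓡 n) p).right_inv hyt] at hy
    exact hy
  have hd := hasDerivAt_comp_line (hΨ.differentiableAt (by simp)) X
  have hlog := ((hd.div_const (Ψ x)).clog_real (by simpa using hs))
  have him : HasDerivAt (fun t : ℝ => c + (Complex.log (Ψ (x + t • X) / Ψ x)).im)
      (fderiv ℝ Ψ x X / Ψ x).im 0 := by
    have h2 := (Complex.imCLM.hasFDerivAt.comp_hasDerivAt (0 : ℝ) hlog).const_add c
    simpa [h1] using h2
  have hm := mfderiv_eq_fderiv_inChart (hsm.mdifferentiableAt (by simp))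
  have hu : fderiv ℝ (inChart f p) x X = (fderiv ℝ Ψ x X / Ψ x).im := hasDerivAt_line_unique hin
    (hasDerivAt_comp_line ((hL.congr_of_eventuallyEq hin).differentiableAt (by simp)) X) him
  exact (DFunLike.congr_fun hm X).trans hu

end Manifold

end HyperbolicQuadric

/-! ### Assembly of the theorem -/

theorem mainTheorem2 (n : ℕ) {M : Type*} [TopologicalSpace M]
    [ChartedSpace (EuclideanSpace ℝ (Fin n)) M] [IsManifold (𝓡 n) ∞ M]
    (a b : M → Fin (n + 2) → ℝ) (h : IsSpacelikeWithNormal a b) :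
    -- the Gauss map is a smooth immersion
    (ContMDiff (𝓡 n) 𝓘(ℝ, Fin n → ℂ) ∞ (gaussMap h) ∧
      ∀ (p : M) (X : TangentSpace (𝓡 n) p), X ≠ 0 →
        0 < metric (gaussMap h p) (mfderiv (𝓡 n) 𝓘(ℝ, Fin n → ℂ) (gaussMap h) p X)
          (mfderiv (𝓡 n) 𝓘(ℝ, Fin n → ℂ) (gaussMap h) p X)) ∧
    -- principal curvature functions exist, and for any such functions:
    (∃ lam : Fin n → M → ℝ, IsPrincipalCurvatures a b lam) ∧
    ∀ lam : Fin n → M → ℝ, IsPrincipalCurvatures a b lam →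
      -- the formula with the sum of the arctangents
      (ContMDiff (𝓡 n) 𝓘(ℝ, ℝ) ∞ (fun q => ∑ j, Real.arctan (lam j q)) ∧
        ∀ (p : M) (X : TangentSpace (𝓡 n) p),
          maslovForm (gaussMap h) p X =
            1 / n * dFun (fun q => ∑ j, Real.arctan (lam j q)) p X) ∧
      -- the formula with the logarithm, for every continuous local branch, which exists
      (∀ p : M, ∃ U : Set M, IsOpen U ∧ p ∈ U ∧ ∃ ell : M → ℂ, ContinuousOn ell U ∧
        ∀ q ∈ U, Complex.exp (ell q) = ∏ j, (1 + Complex.I * lam j q)) ∧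
      ∀ (U : Set M) (ell : M → ℂ), IsOpen U → ContinuousOn ell U →
        (∀ q ∈ U, Complex.exp (ell q) = ∏ j, (1 + Complex.I * lam j q)) →
        ContMDiffOn (𝓡 n) 𝓘(ℝ, ℝ) ∞ (fun q => (ell q).im) U ∧
          ∀ p ∈ U, ∀ X : TangentSpace (𝓡 n) p,
            maslovForm (gaussMap h) p X =
              1 / n * dFun (fun q => (ell q).im) p X := by
  refine ⟨⟨h.contMDiff_gaussMap, h.metric_gaussMap_pos⟩, h.exists_principalCurvatures,
    fun lam hl => ?_⟩
  -- Near `p`, `Ψ p` is the coordinate expression of the product of the `1 + i λ_j`, and it is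
  -- smooth even where the factors are not.
  let Ψ : M → EuclideanSpace ℝ (Fin n) → ℂ := fun p => angleDet (inChart a p) (inChart b p) 1
  have hΨ : ∀ p, ContDiffAt ℝ ∞ (Ψ p) (extChartAt (𝓡 n) p p) := fun p =>
    (h.isLocalFront p).contDiffAt_angleDet 1
  have hΨ0 : ∀ p, Ψ p (extChartAt (𝓡 n) p p) ≠ 0 := fun p =>
    ((h.isLocalFront p).hasDerivAt_angleDet (h.nullCoord_ne_zero p) 0).1
  have hprod : ∀ p, ∀ᶠ q in nhds p, Ψ p (extChartAt (𝓡 n) p q) =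
      ∏ j, (1 + Complex.I * lam j q) := fun p => by
    filter_upwards [h.eventually_angleDet hl p] with q hq
    simpa using hq 1
  have hΨc : ∀ p, ContinuousAt (fun q => Ψ p (extChartAt (𝓡 n) p q)) p := fun p =>
    ContinuousAt.comp (f := extChartAt (𝓡 n) p) (hΨ p).continuousAt (continuousAt_extChartAt p)
  have harc : ∀ p, ∀ᶠ q in nhds p,
      ∑ j, Real.arctan (lam j q) = ∑ j, Real.arctan (lam j p) +
        (Complex.log (Ψ p (extChartAt (𝓡 n) p q) / Ψ p (extChartAt (𝓡 n) p p))).im := by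
    intro p
    have := sum_arctan_eventually_eq
      (Φ := fun t q => angleDet (inChart a p) (inChart b p) t (extChartAt (𝓡 n) p q))
      (h.eventually_angleDet hl p) fun t _ => by
        have h1 : ContinuousAt (fun z : M × ℝ => (extChartAt (𝓡 n) p z.1, z.2)) (p, t) :=
          (ContinuousAt.comp (f := Prod.fst) (continuousAt_extChartAt (I := 𝓡 n) p)
            continuousAt_fst).prodMk continuousAt_snd
        exact ContinuousAt.comp (f := fun z : M × ℝ => (extChartAt (𝓡 n) p z.1, z.2))
          ((h.isLocalFront p).continuousAt_angleDet t) h1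
    simpa only [Complex.log_im] using this
  have hsum := fun p => contMDiffAt_of_eventually_eq_log (hΨ p) (hΨ0 p) _ (harc p)
  refine ⟨⟨fun p => (hsum p).1, fun p X => ?_⟩, fun p => ?_, fun U ell hU hell hexp => ?_⟩
  · rw [(hsum p).2 X]
    exact h.maslovForm_gaussMap p X
  · have hc : Continuous fun q => ∏ j, (1 + Complex.I * lam j q) :=
      continuous_iff_continuousAt.2 fun q => (hΨc q).congr (hprod q)
    have h0 : ∀ q, ∏ j, (1 + Complex.I * lam j q) ≠ 0 := fun q =>
      Finset.prod_ne_zero_iff.2 fun j _ => one_add_I_mul_ne_zero _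
    have hr : Continuous fun q =>
      (∏ j, (1 + Complex.I * lam j q)) / ∏ j, (1 + Complex.I * lam j p) := hc.div_const _
    -- A branch near `p`: the principal logarithm of the product divided by its value at `p`, where
    -- this quotient stays off the cut, plus a logarithm of that value.
    refine ⟨_, Complex.isOpen_slitPlane.preimage hr, ?_, fun q =>
      Complex.log ((∏ j, (1 + Complex.I * lam j q)) / ∏ j, (1 + Complex.I * lam j p)) +
        Complex.log (∏ j, (1 + Complex.I * lam j p)), ?_, fun q _ => ?_⟩
    · rw [Set.mem_preimage, div_self (h0 p)]
      exact Complex.one_mem_slitPlane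
    · exact (hr.continuousOn.clog fun q hq => hq).add continuousOn_const
    · rw [Complex.exp_add, Complex.exp_log (div_ne_zero (h0 q) (h0 p)), Complex.exp_log (h0 p),
        div_mul_cancel₀ _ (h0 p)]
  · have hlog : ∀ p ∈ U, ∀ᶠ q in nhds p, (ell q).im = (ell p).im +
        (Complex.log (Ψ p (extChartAt (𝓡 n) p q) / Ψ p (extChartAt (𝓡 n) p p))).im := by
      intro p hp
      filter_upwards [log_branch_eventually_eq (hell.continuousAt (hU.mem_nhds hp))
        (by
          filter_upwards [hU.mem_nhds hp, hprod p] with q hq hq'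
          rw [hexp q hq, hq']) (hΨc p)] with q hq
      rw [hq, Complex.add_im]
    have hd := fun p hp => contMDiffAt_of_eventually_eq_log (hΨ p) (hΨ0 p) _ (hlog p hp)
    refine ⟨fun p hp => (hd p hp).1.contMDiffWithinAt, fun p hp X => ?_⟩
    rw [(hd p hp).2 X]
    exact h.maslovForm_gaussMap p X
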